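/- Let $p,q\ge 2$ be integers. For $\beta,h\in\mathbb R$ and $N\ge1$ let $\mathbb P_{\beta,h,N}$ be the probability measure on $\{1,\dots,q\}^N$ with $\mathbb P_{\beta,h,N}(X)\propto\exp\big(\beta N\sum_{r=1}^q\bar X_{\cdot r}^p+Nh\bar X_{\cdot1}\big)$, where $\bar X_{\cdot r}=N^{-1}\#\{i: X_i=r\}$, and let $\bar{\boldsymbol X}_N=(\bar X_{\cdot1},\dots,\bar X_{\cdot q})$. On the set $\mathcal P_q$ of probability vectors in $\mathbb R^q$ put $H_{\beta,h}(t)=\beta\sum_r t_r^p+ht_1-\sum_r t_r\log t_r$. Let $\beta>0$, $h\ge0$ and suppose that $(\beta,h)$ is critical: $H_{\beta,h}$ has more than one global maximizer on $\mathcal P_q$, and for each global maximizer $m$ the quadratic form $t\mapsto\sum_r\big(\beta p(p-1)m_r^{p-2}-1/m_r\big)t_r^2$ is negative definite on $\{t\in\mathbb R^q:\sum_r t_r=0\}$. Write $$x_s=\Big(\tfrac{1+(q-1)s}{q},\tfrac{1-s}{q},\dots,\tfrac{1-s}{q}\Big),\qquad f_{\beta,h}(s)=H_{\beta,h}(x_s),\qquad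 k(x)=\beta x^p-x\log x .$$ Then $H_{\beta,h}$ has finitely many global maximizers $m_1,\dots,m_K$, each $m_i$ is a permutation of $x_{s_i}$ for some $s_i\in[0,1)$, and the following hold. 1. Under $\mathbb P_{\beta,h,N}$, as $N\to\infty$, the law of $\bar{\boldsymbol X}_N$ converges weakly to $\sum_{k=1}^K p_k\delta_{m_k}$, where $$p_k=\frac{\tau(m_k)}{\sum_{i=1}^K\tau(m_i)},\qquad \tau(m_i)=\sqrt{\frac{\big(-f_{\beta,h}''(s_i)\big)^{-1}\big(-k''(\tfrac{1-s_i}{q})\big)^{2-q}}{\prod_{r=1}^q m_{i,r}}}.$$ 2. Let $\bar\beta,\bar h\in\mathbb R$, $\beta_N=\beta+\bar\beta/\sqrt N$, $h_N=h+\bar h/\sqrt N$, and let $\varepsilon>0$ be smaller than the Euclidean distance between any two distinct global maximizers. For each $i$ and each permutation matrix $P$ with $m_i=Px_{s_i}$, the matrix $P\Sigma P^\top$ is positive semidefinite and, under $\mathbb P_{\beta_N,h_N,N}(\,\cdot\mid\|\bar{\boldsymbol X}_N-m_i\|_2<\varepsilon)$, as $N\to\infty$, $$\sqrt N(\bar{\boldsymbol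 X}_N-m_i)\xrightarrow{D}\mathcal N_q\big(P\Sigma P^\top(\bar\beta p\,m_i^{p-1}+\bar h e_1),\,P\Sigma P^\top\big),$$ where $m_i^{p-1}$ is taken coordinatewise, $e_1=(1,0,\dots,0)$, and, with $\rho=k''(\tfrac{1+(q-1)s_i}{q})/k''(\tfrac{1-s_i}{q})$, the $q\times q$ matrix $\Sigma=\Sigma(s_i)$ is $\big(-\tfrac{q^2}{q-1}f_{\beta,h}''(s_i)\big)^{-1}$ times the symmetric matrix with $(1,1)$ entry $q-1$, entries $(1,r)$ and $(r,1)$ equal to $-1$ for $r\ge2$, diagonal entries $1+(q-2)\rho$ for $r\ge2$, and off-diagonal entries $-\rho$ for $r\ne r'$, $r,r'\ge2$. (For $q=2$ the number $\rho$ does not enter.) -/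

import Mathlib

open MeasureTheory ProbabilityTheory Filter Topology

noncomputable section

namespace TensorPotts

/-- The space `ℝ^q` with the Euclidean norm. Colours are indexed by `Fin q`, and the colour called
`1` in the mathematics is the index `0 : Fin q`. -/
abbrev Vec (q : ℕ) : Type := EuclideanSpace ℝ (Fin q)

/-- The empirical magnetization vector of a configuration `x`: its `r`-th coordinate is the
proportion of sites of colour `r`. -/
def magnetization {q N : ℕ} (x : Fin N → Fin q) : Vec q :=
  WithLp.toLp 2 fun r => (∑ i : Fin N, if x i = r then (1 : ℝ) else 0) / N

/-- The unnormalized weight `exp (β N ∑_r X̄_r ^ p + N h X̄_1)` of a configuration. -/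
def weight {q : ℕ} [NeZero q] (p N : ℕ) (β h : ℝ) (x : Fin N → Fin q) : ℝ :=
  Real.exp (β * N * ∑ r, magnetization x r ^ p + N * h * magnetization x 0)

/-- The `p`-tensor Curie-Weiss Potts model with `q` colours on `N` sites, as a measure on the
finite set of configurations. -/
def potts (p q : ℕ) [NeZero q] (N : ℕ) (β h : ℝ) : Measure (Fin N → Fin q) :=
  ∑ x : Fin N → Fin q,
    ENNReal.ofReal (weight p N β h x / ∑ y : Fin N → Fin q, weight p N β h y) • Measure.dirac x

instance isProbabilityMeasure_potts (p q : ℕ) [NeZero q] (N : ℕ) (β h : ℝ) :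
    IsProbabilityMeasure (potts p q N β h) := by
  have hpos : ∀ x : Fin N → Fin q, 0 < weight p N β h x := fun x => Real.exp_pos _
  have hsum : 0 < ∑ y : Fin N → Fin q, weight p N β h y :=
    Finset.sum_pos (fun y _ => hpos y) ⟨fun _ => 0, Finset.mem_univ _⟩
  constructor
  simp only [potts, Measure.coe_finsetSum, Finset.sum_apply, Measure.smul_apply,
    measure_univ, smul_eq_mul, mul_one]
  rw [← ENNReal.ofReal_sum_of_nonneg (fun x _ => (div_pos (hpos x) hsum).le),
    ← Finset.sum_div, div_self hsum.ne', ENNReal.ofReal_one]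

/-- The set of `q`-dimensional probability vectors. -/
def probVectors (q : ℕ) : Set (Vec q) := {t | (∀ r, 0 ≤ t r) ∧ ∑ r, t r = 1}

/-- The negative free energy (with `0 log 0 = 0`). -/
def H {q : ℕ} [NeZero q] (p : ℕ) (β h : ℝ) (t : Vec q) : ℝ :=
  β * ∑ r, t r ^ p + h * t 0 - ∑ r, t r * Real.log (t r)

/-- The set of global maximizers of the negative free energy on the probability vectors. -/
def maximizers (p q : ℕ) [NeZero q] (β h : ℝ) : Set (Vec q) :=
  {m | m ∈ probVectors q ∧ IsMaxOn (H p β h) (probVectors q) m}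

/-- The quadratic form `Q_{s,β}`. -/
def Q {q : ℕ} (p : ℕ) (β : ℝ) (s t : Vec q) : ℝ :=
  ∑ r, (β * p * (p - 1) * s r ^ (p - 2) - 1 / s r) * t r ^ 2

/-- A critical point: several global maximizers, at each of which the quadratic form is negative
definite on the hyperplane of vectors with coordinate sum zero. -/
def IsCritical (p q : ℕ) [NeZero q] (β h : ℝ) : Prop :=
  (maximizers p q β h).Nontrivial ∧
    ∀ m ∈ maximizers p q β h, ∀ t : Vec q, ∑ r, t r = 0 → t ≠ 0 → Q p β m t < 0

/-- The vector `x_s = ((1 + (q - 1) s) / q, (1 - s) / q, …, (1 - s) / q)`. -/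
def xvec (q : ℕ) [NeZero q] (s : ℝ) : Vec q :=
  WithLp.toLp 2 fun r => if r = 0 then (1 + (q - 1) * s) / q else (1 - s) / q

/-- `k(x) = β x ^ p - x log x`. -/
def k (p : ℕ) (β x : ℝ) : ℝ := β * x ^ p - x * Real.log x

/-- The second derivative of `k`. -/
def k'' (p : ℕ) (β x : ℝ) : ℝ := iteratedDeriv 2 (k p β) x

/-- `f_{β,h}(s) = H_{β,h}(x_s)`. -/
def f (p q : ℕ) [NeZero q] (β h s : ℝ) : ℝ := H p β h (xvec q s)

/-- The second derivative of `f_{β,h}`. -/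
def f'' (p q : ℕ) [NeZero q] (β h s : ℝ) : ℝ := iteratedDeriv 2 (f p q β h) s

/-- The unnormalized mixture weight of a maximizer `m` that is a permutation of `x_s`. -/
def tau (p q : ℕ) [NeZero q] (β h s : ℝ) (m : Vec q) : ℝ :=
  Real.sqrt ((-f'' p q β h s)⁻¹ * (-k'' p β ((1 - s) / q)) ^ (2 - (q : ℤ)) / ∏ r, m r)

/-- The matrix `Σ` attached to the parameter `s`. -/
def Sig (p q : ℕ) [NeZero q] (β h s : ℝ) : Matrix (Fin q) (Fin q) ℝ :=
  (-((q : ℝ) ^ 2 / (q - 1)) * f'' p q β h s)⁻¹ •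
    Matrix.of fun r r' =>
      if r = 0 ∧ r' = 0 then (q : ℝ) - 1
      else if r = 0 ∨ r' = 0 then -1
      else if r = r' then
        1 + (q - 2) * (k'' p β ((1 + (q - 1) * s) / q) / k'' p β ((1 - s) / q))
      else -(k'' p β ((1 + (q - 1) * s) / q) / k'' p β ((1 - s) / q))

/-- The product `P x` of a matrix with a Euclidean vector. -/
def mulVec {q : ℕ} (P : Matrix (Fin q) (Fin q) ℝ) (x : Vec q) : Vec q :=
  WithLp.toLp 2 (P.mulVec x)

/-- The vector `β̄ p m ^ (p - 1) + h̄ e_1`, with the power taken coordinatewise. -/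
def drift {q : ℕ} [NeZero q] (p : ℕ) (β' h' : ℝ) (m : Vec q) : Vec q :=
  WithLp.toLp 2 fun r => β' * p * m r ^ (p - 1) + h' * (if r = 0 then 1 else 0)

/-- Weak convergence of a sequence of finite measures on `ℝ^q`. -/
def WeakConv {q : ℕ} (μ : ℕ → Measure (Vec q)) (ν : Measure (Vec q)) : Prop :=
  ∀ g : BoundedContinuousFunction (Vec q) ℝ,
    Tendsto (fun N => ∫ x, g x ∂(μ N)) atTop (𝓝 (∫ x, g x ∂ν))

end TensorPotts

end

noncomputable section

namespace TensorPotts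

/-! The argument is Laplace's method on the simplex, carried out on the lattice of proportions. The
weight depends on a configuration only through its colour counts, and
`multinomial_eq_stirlingFactor` splits the number of configurations with given counts into a
Stirling prefactor and the exponential of `N` times the entropy. A sum over configurations thus
becomes a sum over proportions `t` of a prefactor times `exp (N H(t))`, with an extra exponent of
order `√N` times a first-order increment when the parameters are perturbed.

Around a maximizer `m`, at scale `1/√N`, the linear part of `H` vanishes on the zero-sum hyperplane
(the Lagrange condition), so the exponent tends to `Q/2` plus the linear form given by `drift`. The
lattice sum equals the integral of a step function of the `q - 1` free coordinates
(`sum_piAntidiag_eq_integral`), so dominated convergence yields the local asymptotics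
`tendsto_sum_weight`. The quadratic decay of `H` near `m` (`exists_H_sub_le`) supplies the
dominating Gaussian. Configurations away from all maximizers contribute a polynomial times `exp (-N
η)` (`tendsto_sum_weight_of_away`).

The constants are explicit because of the shape of a maximizer. As `k''` is nondecreasing and `Q` is
negative definite, `k''` is negative at every coordinate but a dominant one, and the Lagrange
condition makes those coordinates equal (`maximizer_eq_of_ne`). In the coordinates other than the
dominant one, `-Q` is then a scalar matrix plus a rank-one matrix. Its determinant, together with `∏
m_r` from Stirling, gives `tau`; its inverse, lifted to the hyperplane, is a permuted `Sig`; the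
linear form shifts the mean to that covariance applied to `drift`.

Both limit theorems are quotients of these asymptotics, for a test function and for the constant 1,
in which the remaining normalization cancels. -/

/-! ### Stirling's formula and multinomial coefficients -/

/-- The quotient `n! / (n / e) ^ n`, which is asymptotic to `√(2 π n)`. -/
def stirlingFactor (n : ℕ) : ℝ := n.factorial / ((n : ℝ) / Real.exp 1) ^ n

lemma div_exp_pow_pos (n : ℕ) : 0 < ((n : ℝ) / Real.exp 1) ^ n := by
  rcases Nat.eq_zero_or_pos n with rfl | hn
  · simp
  · positivity

lemma stirlingFactor_pos (n : ℕ) : 0 < stirlingFactor n :=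
  div_pos (by positivity) (div_exp_pow_pos n)

lemma sqrt_le_stirlingFactor (n : ℕ) : √(2 * Real.pi * n) ≤ stirlingFactor n := by
  rw [stirlingFactor, le_div_iff₀ (div_exp_pow_pos n)]
  exact Stirling.le_factorial_stirling n

lemma sqrt_le_stirlingFactor' (n : ℕ) : √(n : ℝ) ≤ stirlingFactor n :=
  (Real.sqrt_le_sqrt (by nlinarith [Real.pi_gt_three, (Nat.cast_nonneg n : (0 : ℝ) ≤ n)])).trans
    (sqrt_le_stirlingFactor n)

/-- At `n = 0` the quotient is `0! / 0 ^ 0 = 1`, so empty colours need no exception. This keeps the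
later bounds valid up to the boundary of the simplex. -/
lemma one_le_stirlingFactor (n : ℕ) : 1 ≤ stirlingFactor n := by
  rcases Nat.eq_zero_or_pos n with rfl | hn
  · simp [stirlingFactor]
  · refine le_trans ?_ (sqrt_le_stirlingFactor' n)
    rw [Real.one_le_sqrt]
    exact_mod_cast hn

lemma stirlingFactor_eq (n : ℕ) (hn : n ≠ 0) :
    stirlingFactor n = Stirling.stirlingSeq n * √(2 * n) := by
  have : (0 : ℝ) < n := by positivity
  rw [stirlingFactor, Stirling.stirlingSeq]
  field_simp

lemma tendsto_stirlingFactor_div_sqrt :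
    Tendsto (fun n : ℕ => stirlingFactor n / √(n : ℝ)) atTop (𝓝 (√(2 * Real.pi))) := by
  have h := Stirling.tendsto_stirlingSeq_sqrt_pi.mul_const (√2)
  rw [← Real.sqrt_mul Real.pi_pos.le, mul_comm] at h
  refine h.congr' ?_
  filter_upwards [eventually_ne_atTop 0] with n hn
  have : (0 : ℝ) < √n := by positivity
  rw [stirlingFactor_eq n hn, Real.sqrt_mul (by norm_num)]
  field_simp

lemma exists_stirlingFactor_le : ∃ C : ℝ, 0 < C ∧ ∀ n : ℕ, n ≠ 0 → stirlingFactor n ≤ C * √(n : ℝ) := by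
  obtain ⟨C, hC⟩ := tendsto_stirlingFactor_div_sqrt.bddAbove_range
  refine ⟨max C 1, by positivity, fun n hn => ?_⟩
  have : (0 : ℝ) < √n := by positivity
  have h := hC ⟨n, rfl⟩
  simp only at h
  rw [div_le_iff₀ this] at h
  exact h.trans (by gcongr; exact le_max_left _ _)

/-- An exact identity, not an asymptotic one: the powers of `e` cancel because the counts add up to
`N`, and the remaining powers `(N / n_r) ^ n_r` form the exponential of the entropy. -/
lemma multinomial_eq_stirlingFactor {ι : Type*} [Fintype ι] (n : ι → ℕ) (N : ℕ) (hN : N ≠ 0)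
    (hn : ∑ r, n r = N) :
    (Nat.multinomial Finset.univ n : ℝ) = stirlingFactor N / (∏ r, stirlingFactor (n r)) *
      Real.exp (-(N * ∑ r, ((n r : ℝ) / N) * Real.log ((n r : ℝ) / N))) := by
  have hspec : (∏ r, ((n r).factorial : ℝ)) * (Nat.multinomial Finset.univ n : ℝ)
      = (N.factorial : ℝ) := by
    rw [← hn]; exact_mod_cast Nat.multinomial_spec Finset.univ n
  have hf : ∀ k : ℕ, (k.factorial : ℝ) = stirlingFactor k * ((k : ℝ) / Real.exp 1) ^ k := by
    intro k
    rw [stirlingFactor, div_mul_cancel₀ _ (div_exp_pow_pos k).ne']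
  have hNpos : (0 : ℝ) < N := by positivity
  have hexp : Real.exp (-(N * ∑ r, ((n r : ℝ) / N) * Real.log ((n r : ℝ) / N))) *
      (∏ r, ((n r : ℝ) / Real.exp 1) ^ n r) = ((N : ℝ) / Real.exp 1) ^ N := by
    rw [Finset.mul_sum, ← Finset.sum_neg_distrib, Real.exp_sum, ← Finset.prod_mul_distrib]
    conv_rhs => rw [← hn, ← Finset.prod_pow_eq_pow_sum]
    refine Finset.prod_congr rfl fun r _ => ?_
    rcases Nat.eq_zero_or_pos (n r) with h0 | hpos
    · simp [h0]
    · have hr : (0 : ℝ) < n r := by positivity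
      have h1 : -((N : ℝ) * ((n r : ℝ) / N * Real.log ((n r : ℝ) / N)))
          = (n r : ℝ) * Real.log ((N : ℝ) / n r) := by
        rw [show (N : ℝ) / n r = ((n r : ℝ) / N)⁻¹ by rw [inv_div], Real.log_inv]
        field_simp
      rw [h1, Real.exp_nat_mul, Real.exp_log (by positivity), ← mul_pow, hn]
      congr 1
      field_simp
  have hpf : (∏ r, stirlingFactor (n r)) ≠ 0 :=
    (Finset.prod_pos fun r _ => stirlingFactor_pos _).ne'
  have hpd : (∏ r, ((n r : ℝ) / Real.exp 1) ^ n r) ≠ 0 :=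
    (Finset.prod_pos fun r _ => div_exp_pow_pos _).ne'
  simp_rw [hf] at hspec
  rw [Finset.prod_mul_distrib, ← hexp] at hspec
  rw [div_mul_eq_mul_div, eq_div_iff hpf]
  apply mul_right_cancel₀ hpd
  linarith

/-- Both sides are the coefficient of the monomial with exponent `n` in `(∑ X_r) ^ N`, expanded over
words on one side and by the multinomial theorem on the other. -/
lemma card_filter_count_eq_multinomial {ι : Type*} [Fintype ι] [DecidableEq ι] (N : ℕ) (n : ι → ℕ)
    (hn : ∑ r, n r = N) :
    (Finset.univ.filter fun x : Fin N → ι => ∀ r, (Finset.univ.filter fun i => x i = r).card = n r).card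
      = Nat.multinomial Finset.univ n := by
  classical
  have h1 := Finset.sum_pow_eq_sum_piAntidiag Finset.univ (fun r : ι => (MvPolynomial.X r : MvPolynomial ι ℕ)) N
  rw [Finset.sum_pow'] at h1
  have h2 := congrArg (MvPolynomial.coeff (Finsupp.equivFunOnFinite.symm n)) h1
  rw [MvPolynomial.coeff_sum, MvPolynomial.coeff_sum] at h2
  have h3 : ∀ x : Fin N → ι, (∏ i, (MvPolynomial.X (x i) : MvPolynomial ι ℕ)) =
      MvPolynomial.monomial (Finsupp.equivFunOnFinite.symm fun r =>
        (Finset.univ.filter fun i => x i = r).card) 1 := by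
    intro x
    rw [← Finset.prod_fiberwise Finset.univ x, MvPolynomial.monomial_eq, Finsupp.prod_fintype]
    · simp only [map_one, one_mul]
      refine Finset.prod_congr rfl fun r _ => ?_
      rw [Finset.prod_congr rfl (g := fun _ => (MvPolynomial.X r : MvPolynomial ι ℕ))]
      · simp
      · intro i hi; rw [(Finset.mem_filter.1 hi).2]
    · simp
  have h4 : ∀ k : ι → ℕ, ((Nat.multinomial Finset.univ k : ℕ) : MvPolynomial ι ℕ) *
      ∏ i, (MvPolynomial.X i : MvPolynomial ι ℕ) ^ k i
      = MvPolynomial.monomial (Finsupp.equivFunOnFinite.symm k) (Nat.multinomial Finset.univ k) := by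
    intro k
    rw [MvPolynomial.monomial_eq, Finsupp.prod_fintype]
    · simp
    · simp
  simp_rw [h3, h4, MvPolynomial.coeff_monomial, EmbeddingLike.apply_eq_iff_eq] at h2
  rw [Finset.sum_ite_eq' _ n] at h2
  rw [if_pos (by simp [hn])] at h2
  rw [← h2, Finset.card_filter, Fintype.piFinset_univ]
  simp [funext_iff]

/-! ### From sums over configurations to integrals over lattice cells -/

/-- The vector of proportions `n / N`. -/
def proportions {q : ℕ} (N : ℕ) (n : Fin q → ℕ) : Vec q := WithLp.toLp 2 fun r => (n r : ℝ) / N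

lemma sum_magnetization {q N : ℕ} (F : Vec q → ℝ) :
    ∑ x : Fin N → Fin q, F (magnetization x) =
      ∑ n ∈ Finset.piAntidiag Finset.univ N, (Nat.multinomial Finset.univ n : ℝ) *
        F (proportions N n) := by
  classical
  have hmag : ∀ x : Fin N → Fin q, magnetization x =
      proportions N fun r => (Finset.univ.filter fun i => x i = r).card := by
    intro x
    simp [magnetization, proportions]
  have hmaps : ∀ x ∈ (Finset.univ : Finset (Fin N → Fin q)),
      (fun r => (Finset.univ.filter fun i => x i = r).card) ∈
        Finset.piAntidiag (Finset.univ : Finset (Fin q)) N := by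
    intro x _
    rw [Finset.mem_piAntidiag]
    refine ⟨?_, fun _ _ => Finset.mem_univ _⟩
    rw [← Finset.card_eq_sum_card_fiberwise (f := x) (s := Finset.univ) (t := Finset.univ)
      (fun _ _ => Finset.mem_coe.2 (Finset.mem_univ _))]
    simp
  rw [← Finset.sum_fiberwise_of_maps_to hmaps]
  refine Finset.sum_congr rfl fun n hn => ?_
  rw [Finset.mem_piAntidiag] at hn
  rw [← card_filter_count_eq_multinomial N n hn.1, ← nsmul_eq_mul, ← Finset.sum_const]
  refine Finset.sum_congr ?_ fun x hx => ?_
  · ext x; simp [funext_iff]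
  · rw [hmag]
    congr 1
    congr 1
    simp only [Finset.mem_filter, Finset.mem_univ, true_and] at hx
    funext r
    rw [hx r]

/-- The fibre over each lattice point is a unit cube. Hence a sum over the lattice is the Lebesgue
integral of a step function, which makes dominated convergence available. -/
lemma map_floor_volume {κ : Type*} [Fintype κ] :
    (volume : Measure (κ → ℝ)).map (fun u r => ⌊u r⌋) = (Measure.count : Measure (κ → ℤ)) := by
  have hmeas : Measurable (fun (u : κ → ℝ) r => ⌊u r⌋) := by
    refine measurable_pi_lambda _ fun r => Int.measurable_floor.comp (measurable_pi_apply r)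
  refine Measure.ext_of_singleton fun z => ?_
  rw [Measure.map_apply hmeas (measurableSet_singleton z), Measure.count_singleton]
  have : (fun (u : κ → ℝ) r => ⌊u r⌋) ⁻¹' {z} =
      Set.univ.pi fun r => Set.Ico ((z r : ℝ)) (z r + 1) := by
    ext u
    simp [funext_iff, Int.floor_eq_iff]
  rw [this, volume_pi_pi]
  simp

/-- The integer vector with coordinate sum `N` whose coordinates other than `r₀` are given. -/
def latticePoint {q : ℕ} (r₀ : Fin q) (N : ℕ) (z : {r // r ≠ r₀} → ℤ) (r : Fin q) : ℤ :=
  if hr : r = r₀ then N - ∑ j, z j else z ⟨r, hr⟩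

lemma sum_eq_add_sum_subtype {q : ℕ} {E : Type*} [AddCommMonoid E] (r₀ : Fin q) (g : Fin q → E) :
    ∑ r, g r = g r₀ + ∑ j : {r // r ≠ r₀}, g j := by
  exact Fintype.sum_eq_add_sum_subtype_ne g r₀

lemma sum_latticePoint {q : ℕ} (r₀ : Fin q) (N : ℕ) (z : {r // r ≠ r₀} → ℤ) :
    ∑ r, latticePoint r₀ N z r = N := by
  rw [sum_eq_add_sum_subtype r₀]
  have : ∀ j : {r // r ≠ r₀}, latticePoint r₀ N z j = z j := fun j => by
    simp [latticePoint, j.2]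
  simp_rw [this]
  simp [latticePoint]

/-- Extension by zero to all lattice points of a function on configurations of occupation numbers. -/
def latticeExtend {q : ℕ} (r₀ : Fin q) (N : ℕ) (G : (Fin q → ℕ) → ℝ) (z : {r // r ≠ r₀} → ℤ) : ℝ :=
  if ∀ r, 0 ≤ latticePoint r₀ N z r then G fun r => (latticePoint r₀ N z r).toNat else 0

lemma latticePoint_natCast {q : ℕ} (r₀ : Fin q) (N : ℕ) (n : Fin q → ℕ) (hn : ∑ r, n r = N) (r : Fin q) :
    latticePoint r₀ N (fun j => (n j : ℤ)) r = n r := by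
  by_cases hr : r = r₀
  · subst hr
    have h := sum_eq_add_sum_subtype r (fun r => (n r : ℤ))
    have h' : ∑ r, (n r : ℤ) = N := by exact_mod_cast hn
    simp only [latticePoint, dif_pos]
    linarith
  · simp [latticePoint, hr]

/-- Dropping the coordinate `r₀` is injective on count vectors of sum `N`, and the extension
vanishes off the image. Finiteness of the support is recorded because integrability is derived from
it. -/
lemma tsum_latticeExtend {q : ℕ} (r₀ : Fin q) (N : ℕ) (G : (Fin q → ℕ) → ℝ) :
    (∃ s : Finset ({r // r ≠ r₀} → ℤ), ∀ z ∉ s, latticeExtend r₀ N G z = 0) ∧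
    ∑' z, latticeExtend r₀ N G z = ∑ n ∈ Finset.piAntidiag Finset.univ N, G n := by
  classical
  set S := (Finset.piAntidiag (Finset.univ : Finset (Fin q)) N).image
    (fun n (j : {r // r ≠ r₀}) => (n j : ℤ)) with hS
  have hzero : ∀ z ∉ S, latticeExtend r₀ N G z = 0 := by
    intro z hz
    rw [latticeExtend, if_neg]
    intro hpos
    apply hz
    rw [hS, Finset.mem_image]
    refine ⟨fun r => (latticePoint r₀ N z r).toNat, ?_, ?_⟩
    · rw [Finset.mem_piAntidiag]
      refine ⟨?_, fun _ _ => Finset.mem_univ _⟩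
      have := sum_latticePoint r₀ N z
      zify
      rw [← this]
      exact Finset.sum_congr rfl fun r _ => Int.toNat_of_nonneg (hpos r)
    · funext j
      rw [Int.toNat_of_nonneg (hpos j)]
      simp [latticePoint, j.2]
  refine ⟨⟨S, hzero⟩, ?_⟩
  rw [tsum_eq_sum hzero, hS, Finset.sum_image]
  · refine Finset.sum_congr rfl fun n hn => ?_
    have h := latticePoint_natCast r₀ N n (Finset.mem_piAntidiag.1 hn).1
    rw [latticeExtend, if_pos (fun r => by rw [h r]; positivity)]
    congr 1
    funext r
    rw [h r]
    simp
  · intro n hn n' hn' heq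
    funext r
    have h := latticePoint_natCast r₀ N n (Finset.mem_piAntidiag.1 hn).1 r
    have h' := latticePoint_natCast r₀ N n' (Finset.mem_piAntidiag.1 hn').1 r
    simp only at heq
    rw [heq] at h
    exact_mod_cast h.symm.trans h'

lemma integral_latticeExtend_floor {q : ℕ} (r₀ : Fin q) (N : ℕ) (G : (Fin q → ℕ) → ℝ) :
    ∫ u : {r // r ≠ r₀} → ℝ, latticeExtend r₀ N G (fun r => ⌊u r⌋) =
      ∑ n ∈ Finset.piAntidiag Finset.univ N, G n := by
  have hmeas : Measurable (fun (u : {r // r ≠ r₀} → ℝ) r => ⌊u r⌋) :=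
    measurable_pi_lambda _ fun r => Int.measurable_floor.comp (measurable_pi_apply r)
  obtain ⟨⟨s, hs⟩, hsum⟩ := tsum_latticeExtend r₀ N G
  rw [← hsum, ← integral_map (f := latticeExtend r₀ N G) hmeas.aemeasurable
    (Measurable.of_discrete.aestronglyMeasurable), map_floor_volume,
    integral_countable]
  · simp
  · rw [integrable_count_iff]
    exact summable_of_ne_finset_zero (s := s) fun z hz => by rw [hs z hz, norm_zero]

/-- The substitution `u = N a + √N w` centres the step function at `N a` and zooms in on the
fluctuation scale; `√N ^ (q - 1)` is its Jacobian. -/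
lemma sum_piAntidiag_eq_integral {q : ℕ} (r₀ : Fin q) (N : ℕ) (hN : N ≠ 0) (G : (Fin q → ℕ) → ℝ)
    (a : Fin q → ℝ) :
    ∑ n ∈ Finset.piAntidiag Finset.univ N, G n = √(N : ℝ) ^ (q - 1) *
      ∫ w : {r // r ≠ r₀} → ℝ, latticeExtend r₀ N G (fun r => ⌊N * a r + √N * w r⌋) := by
  have hpos : (0 : ℝ) < √N := by positivity
  rw [← integral_latticeExtend_floor r₀]
  have h := Measure.integral_comp_smul (volume : Measure ({r // r ≠ r₀} → ℝ))
    (fun u => latticeExtend r₀ N G (fun r => ⌊N * a r + u r⌋)) (√N)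
  simp only [Pi.smul_apply, smul_eq_mul] at h
  rw [h]
  have hdim : Module.finrank ℝ ({r // r ≠ r₀} → ℝ) = q - 1 := by
    simp [Module.finrank_fintype_fun_eq_card, Fintype.card_subtype_compl]
  have h2 := integral_add_left_eq_self (μ := (volume : Measure ({r // r ≠ r₀} → ℝ)))
    (fun u => latticeExtend r₀ N G (fun r => ⌊u r⌋)) (fun r => N * a r)
  simp only [Pi.add_apply] at h2
  rw [h2, hdim, abs_of_nonneg (by positivity), ← mul_assoc, mul_inv_cancel₀ (by positivity), one_mul]

/-! ### Gaussian integrals -/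

open Matrix in
lemma ofReal_dotProduct_mulVec {κ κ' : Type*} [Fintype κ] [Fintype κ'] (S : Matrix κ κ' ℝ)
    (x : κ → ℝ) (y : κ' → ℝ) : ((x ⬝ᵥ S *ᵥ y : ℝ) : ℂ) =
      (fun r => (x r : ℂ)) ⬝ᵥ (S.map Complex.ofReal) *ᵥ (fun r => (y r : ℂ)) := by
  simp [dotProduct, Matrix.mulVec]

open Matrix in
lemma integral_comp_mulVec {κ : Type*} [Fintype κ] [DecidableEq κ] (B : Matrix κ κ ℝ) (hB : B.det ≠ 0)
    (F : (κ → ℝ) → ℂ) : ∫ w, F (B *ᵥ w) = ((|B.det|⁻¹ : ℝ) : ℂ) * ∫ v, F v := by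
  have hdet : LinearMap.det (Matrix.toLin' B) ≠ 0 := by rwa [LinearMap.det_toLin']
  have hmap := Real.map_linearMap_volume_pi_eq_smul_volume_pi hdet
  have hemb : MeasurableEmbedding (Matrix.toLin' B) :=
    ((LinearMap.equivOfDetNeZero _ hdet).toContinuousLinearEquiv.toHomeomorph).measurableEmbedding
  have h := hemb.integral_map (μ := volume) F
  rw [hmap, integral_smul_measure, LinearMap.det_toLin'] at h
  simp only [Matrix.toLin'_apply] at h
  rw [← h, ENNReal.toReal_ofReal (abs_nonneg _), abs_inv, Complex.real_smul]

-- Writing `M = Bᵀ B` and substituting `v = B w` reduces to the product Gaussian integral. The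
-- linear coefficient is complex so that characteristic functions can be computed.
open Matrix MatrixOrder in
lemma integral_cexp_neg_quadratic_add {κ : Type*} [Fintype κ] [DecidableEq κ] (M : Matrix κ κ ℝ)
    (hM : M.PosDef) (c : κ → ℂ) :
    ∫ w : κ → ℝ, Complex.exp (-(1 / 2) * ((w ⬝ᵥ M *ᵥ w : ℝ) : ℂ) + ∑ i, c i * (w i : ℂ)) =
      (((2 * Real.pi) ^ ((Fintype.card κ : ℝ) / 2) / √M.det : ℝ) : ℂ) *
        Complex.exp ((c ⬝ᵥ (M⁻¹.map Complex.ofReal) *ᵥ c) / 2) := by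
  obtain ⟨B, hB⟩ : ∃ B : Matrix κ κ ℝ, M = Bᵀ * B := by
    obtain ⟨B, hB⟩ := CStarAlgebra.nonneg_iff_eq_star_mul_self.1 hM.posSemidef.nonneg
    exact ⟨B, by rw [hB, star_eq_conjTranspose, conjTranspose_eq_transpose_of_trivial]⟩
  have hdetM : M.det = B.det ^ 2 := by rw [hB, det_mul, det_transpose]; ring
  have hdet : B.det ≠ 0 := by
    intro h0
    have := hM.det_pos
    rw [hdetM, h0] at this
    simp at this
  have hunit : IsUnit B.det := hdet.isUnit
  set b : κ → ℂ := (B⁻¹ᵀ.map Complex.ofReal) *ᵥ c with hb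
  have hbc : (B⁻¹.map Complex.ofReal)ᵀ *ᵥ c = b := by rw [hb]; rfl
  have h1 := integral_comp_mulVec B hdet
    (fun v => Complex.exp (-(1 / 2 : ℂ) * ∑ i, (v i : ℂ) ^ 2 + ∑ i, b i * (v i : ℂ)))
  rw [GaussianFourier.integral_cexp_neg_mul_sum_add (by norm_num) b] at h1
  have hcast : ∀ w : κ → ℝ, (fun i => (((B *ᵥ w) i : ℝ) : ℂ)) =
      (B.map Complex.ofReal) *ᵥ (fun i => (w i : ℂ)) := by
    intro w; funext i
    simp [Matrix.mulVec, dotProduct]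
  have hinv : (B⁻¹.map Complex.ofReal) * (B.map Complex.ofReal) = (1 : Matrix κ κ ℂ) := by
    have := congrArg (fun X : Matrix κ κ ℝ => X.map Complex.ofRealHom) (Matrix.nonsing_inv_mul B hunit)
    simp only [Matrix.map_mul] at this
    rw [Matrix.map_one _ (map_zero _) (map_one _)] at this
    exact this
  have hL : ∀ w : κ → ℝ, Complex.exp (-(1 / 2) * ((w ⬝ᵥ M *ᵥ w : ℝ) : ℂ) + ∑ i, c i * (w i : ℂ))
      = Complex.exp (-(1 / 2 : ℂ) * ∑ i, (((B *ᵥ w) i : ℝ) : ℂ) ^ 2 +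
        ∑ i, b i * (((B *ᵥ w) i : ℝ) : ℂ)) := by
    intro w
    congr 2
    · congr 1
      have : w ⬝ᵥ M *ᵥ w = ∑ i, (B *ᵥ w) i ^ 2 := by
        rw [hB, ← mulVec_mulVec, dotProduct_mulVec, vecMul_transpose, dotProduct]
        exact Finset.sum_congr rfl fun i _ => by ring
      rw [this]; push_cast; rfl
    · change c ⬝ᵥ (fun i => (w i : ℂ)) = b ⬝ᵥ (fun i => (((B *ᵥ w) i : ℝ) : ℂ))
      rw [hcast, ← hbc, mulVec_transpose, ← dotProduct_mulVec, mulVec_mulVec, hinv, one_mulVec]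
  simp_rw [hL]
  rw [h1]
  have hq : ∑ i, b i ^ 2 = c ⬝ᵥ (M⁻¹.map Complex.ofReal) *ᵥ c := by
    have hMi : M⁻¹ = B⁻¹ * B⁻¹ᵀ := by
      rw [hB, Matrix.mul_inv_rev, Matrix.transpose_nonsing_inv]
    have hmap : M⁻¹.map Complex.ofReal = (B⁻¹.map Complex.ofReal) * (B⁻¹.map Complex.ofReal)ᵀ := by
      rw [hMi]
      exact Matrix.map_mul (f := Complex.ofRealHom)
    rw [hmap, ← mulVec_mulVec, hbc, dotProduct_mulVec, ← mulVec_transpose, hbc, dotProduct]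
    exact Finset.sum_congr rfl fun i _ => by ring
  rw [hq, ← mul_assoc]
  congr 1
  · rw [hdetM, Real.sqrt_sq_eq_abs, div_eq_mul_inv _ |B.det|, Complex.ofReal_mul, mul_comm]
    congr 1
    rw [Complex.ofReal_cpow (by positivity)]
    congr 1
    · push_cast; ring
    · push_cast; ring
  · congr 1; ring

-- Otherwise the Bochner integral would be 0 by convention, whereas the closed formula for it is
-- nonzero.
open Matrix in
lemma integrable_exp_neg_quadratic_add {κ : Type*} [Fintype κ] [DecidableEq κ] (M : Matrix κ κ ℝ)
    (hM : M.PosDef) (c : κ → ℝ) :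
    Integrable fun w : κ → ℝ => Real.exp (-(1 / 2) * (w ⬝ᵥ M *ᵥ w) + ∑ i, c i * w i) := by
  by_contra hni
  have h := integral_cexp_neg_quadratic_add M hM (fun i => (c i : ℂ))
  have h2 : ∀ w : κ → ℝ, Complex.exp (-(1 / 2) * ((w ⬝ᵥ M *ᵥ w : ℝ) : ℂ) +
      ∑ i, (c i : ℂ) * (w i : ℂ)) =
      ((Real.exp (-(1 / 2) * (w ⬝ᵥ M *ᵥ w) + ∑ i, c i * w i) : ℝ) : ℂ) := by
    intro w; push_cast; rfl
  simp_rw [h2] at h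
  rw [integral_complex_ofReal, integral_undef hni] at h
  have hdet := hM.det_pos
  have : (((2 * Real.pi) ^ ((Fintype.card κ : ℝ) / 2) / √M.det : ℝ) : ℂ) ≠ 0 := by
    have : 0 < (2 * Real.pi) ^ ((Fintype.card κ : ℝ) / 2) / √M.det := by positivity
    exact_mod_cast this.ne'
  exact mul_ne_zero this (Complex.exp_ne_zero _) h.symm

open Matrix in
/-- A measure with Gaussian density pushed forward by a linear map is a multiple of a Gaussian. -/
lemma integral_gaussian_density_eq {κ : Type*} [Fintype κ] [DecidableEq κ] {q : ℕ}
    (M : Matrix κ κ ℝ) (hM : M.PosDef) (A : Matrix (Fin q) κ ℝ) (d : Fin q → ℝ)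
    (g : BoundedContinuousFunction (Vec q) ℝ) :
    ∫ w : κ → ℝ, g (WithLp.toLp 2 (A *ᵥ w)) *
        Real.exp (-(1 / 2) * (w ⬝ᵥ M *ᵥ w) + d ⬝ᵥ (A *ᵥ w)) =
      ((2 * Real.pi) ^ ((Fintype.card κ : ℝ) / 2) / √M.det *
        Real.exp (d ⬝ᵥ (A * M⁻¹ * Aᵀ) *ᵥ d / 2)) *
      ∫ x, g x ∂(multivariateGaussian (WithLp.toLp 2 ((A * M⁻¹ * Aᵀ) *ᵥ d)) (A * M⁻¹ * Aᵀ)) := by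
  set S := A * M⁻¹ * Aᵀ with hS
  have hdet := hM.det_pos
  have hSpsd : S.PosSemidef := by
    have := hM.inv.posSemidef.mul_mul_conjTranspose_same A
    simpa [hS] using this
  set Z : ℝ := (2 * Real.pi) ^ ((Fintype.card κ : ℝ) / 2) / √M.det * Real.exp (d ⬝ᵥ S *ᵥ d / 2)
    with hZ
  have hZpos : 0 < Z := by positivity
  set ρ : (κ → ℝ) → ℝ := fun w => Real.exp (-(1 / 2) * (w ⬝ᵥ M *ᵥ w) + d ⬝ᵥ (A *ᵥ w)) with hρ
  have hlin : ∀ w : κ → ℝ, d ⬝ᵥ (A *ᵥ w) = ∑ i, (Aᵀ *ᵥ d) i * w i := by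
    intro w
    rw [dotProduct_mulVec, mulVec_transpose]; rfl
  have hint : Integrable ρ := by
    have := integrable_exp_neg_quadratic_add M hM (Aᵀ *ᵥ d)
    simpa only [hρ, hlin] using this
  have hρm : Measurable ρ := by
    rw [hρ]
    have : Continuous fun w : κ → ℝ => Real.exp (-(1 / 2) * (w ⬝ᵥ M *ᵥ w) + d ⬝ᵥ (A *ᵥ w)) := by
      simp only [dotProduct, Matrix.mulVec]
      fun_prop
    exact this.measurable
  set ν₀ : Measure (κ → ℝ) := volume.withDensity fun w => ENNReal.ofReal (ρ w) with hν₀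
  have hfin : IsFiniteMeasure ν₀ := isFiniteMeasure_withDensity_ofReal hint.2
  have hTm : Measurable fun w : κ → ℝ => (WithLp.toLp 2 (A *ᵥ w) : Vec q) := by
    have : Continuous fun w : κ → ℝ => (WithLp.toLp 2 (A *ᵥ w) : Vec q) := by
      refine (PiLp.continuous_toLp 2 _).comp (continuous_pi fun r => ?_)
      simp only [dotProduct, Matrix.mulVec]
      fun_prop
    exact this.measurable
  set ν : Measure (Vec q) := ν₀.map fun w => WithLp.toLp 2 (A *ᵥ w) with hν
  have hdens : ∀ {E : Type} [NormedAddCommGroup E] [NormedSpace ℝ E] (F : (κ → ℝ) → E),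
      ∫ w, F w ∂ν₀ = ∫ w, ρ w • F w := by
    intro E _ _ F
    rw [hν₀, integral_withDensity_eq_integral_toReal_smul (by fun_prop) (by simp)]
    refine integral_congr_ae (Eventually.of_forall fun w => ?_)
    simp only
    rw [ENNReal.toReal_ofReal (Real.exp_pos _).le]
  set γ := multivariateGaussian (WithLp.toLp 2 (S *ᵥ d)) S with hγ
  -- The two finite measures have the same characteristic function. The transform of `ν` at `t` is a
  -- Gaussian integral with linear coefficient `Aᵀ (d + i t)`. Expanding the quadratic form `S` at
  -- `d + i t`, the part in `d` alone goes into `Z`, the cross term is the mean `S d`, and the part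
  -- in `t` alone is the covariance `S`. No invertibility of `S` is needed.
  have key : ν = ENNReal.ofReal Z • γ := by
    have : IsFiniteMeasure (ENNReal.ofReal Z • γ) := Measure.smul_finite _ ENNReal.ofReal_ne_top
    refine Measure.ext_of_charFun ?_
    funext t
    have hR : charFun (ENNReal.ofReal Z • γ) t = (Z : ℂ) * charFun γ t := by
      rw [charFun_apply, charFun_apply, integral_smul_measure, ENNReal.toReal_ofReal hZpos.le,
        Complex.real_smul]
    rw [hR, hγ, charFun_multivariateGaussian hSpsd, charFun_apply, hν,
      integral_map hTm.aemeasurable (by fun_prop), hdens]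
    set u : Fin q → ℂ := fun r => (d r : ℂ) + (t r : ℂ) * Complex.I with hu
    set c : κ → ℂ := (Aᵀ.map Complex.ofReal) *ᵥ u with hc
    have hw : ∀ w : κ → ℝ, ρ w • Complex.exp ((inner ℝ (WithLp.toLp 2 (A *ᵥ w) : Vec q) t : ℝ) *
        Complex.I) = Complex.exp (-(1 / 2) * ((w ⬝ᵥ M *ᵥ w : ℝ) : ℂ) + ∑ i, c i * (w i : ℂ)) := by
      intro w
      rw [hρ, Complex.real_smul, Complex.ofReal_exp, ← Complex.exp_add]
      congr 1
      have hcw : ∑ i, c i * (w i : ℂ) = ∑ r, u r * (((A *ᵥ w) r : ℝ) : ℂ) := by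
        simp only [hc, Matrix.mulVec, dotProduct, Matrix.map_apply, transpose_apply, Finset.sum_mul]
        push_cast
        simp only [Finset.mul_sum]
        rw [Finset.sum_comm]
        exact Finset.sum_congr rfl fun r _ => Finset.sum_congr rfl fun i _ => by ring
      rw [hcw, PiLp.inner_apply]
      simp only [dotProduct, hu, add_mul, Finset.sum_add_distrib]
      push_cast
      rw [Finset.sum_mul, ← add_assoc]
      congr 1
      exact Finset.sum_congr rfl fun r _ => by simp; ring
    simp_rw [hw]
    rw [integral_cexp_neg_quadratic_add M hM c, hZ, Complex.ofReal_mul, mul_assoc]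
    congr 1
    rw [Complex.ofReal_exp, ← Complex.exp_add]
    congr 1
    have hquad : c ⬝ᵥ (M⁻¹.map Complex.ofReal) *ᵥ c = u ⬝ᵥ (S.map Complex.ofReal) *ᵥ u := by
      have hmap : S.map Complex.ofReal =
          (A.map Complex.ofReal) * (M⁻¹.map Complex.ofReal) * (Aᵀ.map Complex.ofReal) := by
        rw [hS]
        have h1 := Matrix.map_mul (f := Complex.ofRealHom) (L := A * M⁻¹) (M := Aᵀ)
        have h2 := Matrix.map_mul (f := Complex.ofRealHom) (L := A) (M := M⁻¹)
        rw [h2] at h1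
        exact h1
      rw [hmap, hc, ← mulVec_mulVec, ← mulVec_mulVec, dotProduct_mulVec u]
      congr 1
      rw [← mulVec_transpose]
      rfl
    have hu' : u = (fun r => (d r : ℂ)) + Complex.I • (fun r => (t r : ℂ)) := by
      funext r; simp [hu, mul_comm]
    have hin : (inner ℝ t (WithLp.toLp 2 (S *ᵥ d)) : ℝ) = t.ofLp ⬝ᵥ S *ᵥ d := by
      rw [PiLp.inner_apply, dotProduct]
      exact Finset.sum_congr rfl fun r _ => by simp [mul_comm]
    have hST : S.IsSymm := by simpa using hSpsd.isHermitian
    have hcross : (fun r => (d r : ℂ)) ⬝ᵥ (S.map Complex.ofReal) *ᵥ (fun r => (t r : ℂ)) =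
        (fun r => (t r : ℂ)) ⬝ᵥ (S.map Complex.ofReal) *ᵥ (fun r => (d r : ℂ)) := by
      rw [dotProduct_mulVec, ← mulVec_transpose, ← transpose_map, hST.eq, dotProduct_comm]
    rw [hquad, hin, hu', Complex.ofReal_div, Complex.ofReal_ofNat]
    simp only [ofReal_dotProduct_mulVec, add_dotProduct, mulVec_add, dotProduct_add, smul_dotProduct,
      mulVec_smul, dotProduct_smul, smul_eq_mul, hcross]
    linear_combination (1 / 2) * Complex.I_sq * ((fun r => (t r : ℂ)) ⬝ᵥ
      (S.map Complex.ofReal) *ᵥ (fun r => (t r : ℂ)))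
  have h1 : ∫ x, g x ∂ν = ∫ w : κ → ℝ, ρ w • g (WithLp.toLp 2 (A *ᵥ w)) := by
    rw [hν, integral_map hTm.aemeasurable g.continuous.aestronglyMeasurable, hdens]
  rw [key, integral_smul_measure, ENNReal.toReal_ofReal hZpos.le, smul_eq_mul] at h1
  rw [h1]
  refine integral_congr_ae (Eventually.of_forall fun w => ?_)
  simp [hρ, mul_comm]

/-! ### Diagonal quadratic forms on the zero-sum hyperplane -/

/-- The matrix of the parametrization of the hyperplane of vectors with coordinate sum zero by the
coordinates other than `r₀`. -/
def liftMatrix {q : ℕ} (r₀ : Fin q) : Matrix (Fin q) {r // r ≠ r₀} ℝ :=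
  Matrix.of fun r j => if r = r₀ then -1 else if r = j then 1 else 0

/-- The matrix, in the coordinates other than `r₀`, of the diagonal quadratic form with coefficients
`D` on the hyperplane of vectors with coordinate sum zero. -/
def hyperplaneForm {q : ℕ} (r₀ : Fin q) (D : Fin q → ℝ) : Matrix {r // r ≠ r₀} {r // r ≠ r₀} ℝ :=
  Matrix.of fun i j => (if i = j then D i else 0) + D r₀

section

open Matrix

lemma liftMatrix_mulVec_self {q : ℕ} (r₀ : Fin q) (w : {r // r ≠ r₀} → ℝ) :
    (liftMatrix r₀ *ᵥ w) r₀ = -∑ j, w j := by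
  simp [liftMatrix, Matrix.mulVec, dotProduct]

lemma liftMatrix_mulVec_coe {q : ℕ} (r₀ : Fin q) (w : {r // r ≠ r₀} → ℝ) (j : {r // r ≠ r₀}) :
    (liftMatrix r₀ *ᵥ w) j = w j := by
  simp [liftMatrix, Matrix.mulVec, dotProduct, j.2, Subtype.val_inj]

lemma sum_liftMatrix_mulVec {q : ℕ} (r₀ : Fin q) (w : {r // r ≠ r₀} → ℝ) :
    ∑ r, (liftMatrix r₀ *ᵥ w) r = 0 := by
  rw [sum_eq_add_sum_subtype r₀, liftMatrix_mulVec_self]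
  simp_rw [liftMatrix_mulVec_coe]
  ring

lemma dotProduct_hyperplaneForm {q : ℕ} (r₀ : Fin q) (D : Fin q → ℝ) (w : {r // r ≠ r₀} → ℝ) :
    w ⬝ᵥ hyperplaneForm r₀ D *ᵥ w = ∑ r, D r * (liftMatrix r₀ *ᵥ w) r ^ 2 := by
  rw [sum_eq_add_sum_subtype r₀, liftMatrix_mulVec_self]
  simp_rw [liftMatrix_mulVec_coe]
  simp only [hyperplaneForm, Matrix.mulVec, dotProduct, of_apply, add_mul, Finset.sum_add_distrib,
    mul_add, ite_mul, zero_mul, Finset.sum_ite_eq, Finset.mem_univ, if_true]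
  rw [add_comm]
  congr 1
  · rw [← Finset.sum_mul, ← Finset.mul_sum]; ring
  · exact Finset.sum_congr rfl fun j _ => by ring

lemma posDef_hyperplaneForm {q : ℕ} (r₀ : Fin q) (D : Fin q → ℝ)
    (hD : ∀ t : Vec q, ∑ r, t r = 0 → t ≠ 0 → 0 < ∑ r, D r * t r ^ 2) :
    (hyperplaneForm r₀ D).PosDef := by
  refine Matrix.PosDef.of_dotProduct_mulVec_pos ?_ fun w hw => ?_
  · ext i j
    simp only [conjTranspose_apply, hyperplaneForm, of_apply, star_trivial]
    by_cases h : i = j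
    · simp [h]
    · simp [h, Ne.symm h]
  · rw [star_trivial, dotProduct_hyperplaneForm]
    refine hD (WithLp.toLp 2 (liftMatrix r₀ *ᵥ w)) (sum_liftMatrix_mulVec r₀ w) fun h0 => hw ?_
    funext j
    rw [← liftMatrix_mulVec_coe r₀ w j]
    exact congrArg (fun t : Vec q => t j) h0

/-- The form is `B` times the identity plus a rank-one matrix, so the matrix determinant lemma
applies after division by `B`. For `q = 2` the matrix is `1 × 1` and `B` may vanish. -/
lemma det_hyperplaneForm {q : ℕ} (hq : 2 ≤ q) (r₀ : Fin q) (D : Fin q → ℝ) (B : ℝ)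
    (hD : ∀ r, r ≠ r₀ → D r = B) (hB : 3 ≤ q → B ≠ 0) :
    (hyperplaneForm r₀ D).det = B ^ (q - 2) * (B + (q - 1) * D r₀) := by
  have hcard : Fintype.card {r // r ≠ r₀} = q - 1 := by simp [Fintype.card_subtype_compl]
  rcases hq.eq_or_lt with rfl | hq3
  · obtain ⟨j, hj⟩ := Fintype.card_eq_one_iff.1 hcard
    rw [Matrix.det_eq_elem_of_card_eq_one hcard j]
    simp [hyperplaneForm, hD j j.2]
    ring
  · have hB0 := hB hq3
    have hM : hyperplaneForm r₀ D = B • (1 + replicateCol Unit (fun _ => D r₀ / B) *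
        replicateRow Unit (fun _ => (1 : ℝ))) := by
      ext i j
      simp only [hyperplaneForm, of_apply, Matrix.smul_apply, Matrix.add_apply, one_apply, mul_apply,
        replicateCol_apply, replicateRow_apply, hD i i.2, smul_eq_mul]
      by_cases h : i = j
      · simp [h]; field_simp
      · simp [h]; field_simp
    rw [hM, det_smul, det_one_add_replicateCol_mul_replicateRow, hcard]
    obtain ⟨k, rfl⟩ : ∃ k, q = k + 2 := ⟨q - 2, by omega⟩
    simp only [dotProduct, one_mul, Finset.sum_const, Finset.card_univ, hcard, nsmul_eq_mul]
    rw [show k + 2 - 1 = k + 1 by omega, show k + 2 - 2 = k by omega, pow_succ]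
    push_cast
    field_simp
    ring

/-- The covariance matrix attached to coefficients `A` at the coordinate `r₀` and `B` at the others. -/
def covMatrix {q : ℕ} (r₀ : Fin q) (c ρ : ℝ) : Matrix (Fin q) (Fin q) ℝ :=
  c • Matrix.of fun r r' =>
    if r = r₀ ∧ r' = r₀ then (q : ℝ) - 1
    else if r = r₀ ∨ r' = r₀ then -1
    else if r = r' then 1 + (q - 2) * ρ
    else -ρ

lemma covMatrix_symm {q : ℕ} (r₀ : Fin q) (c ρ : ℝ) (r r' : Fin q) :
    covMatrix r₀ c ρ r r' = covMatrix r₀ c ρ r' r := by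
  simp only [covMatrix, Matrix.smul_apply, of_apply, and_comm (a := r = r₀),
    or_comm (a := r = r₀), eq_comm (a := r) (b := r')]

lemma covMatrix_self {q : ℕ} (r₀ : Fin q) (c ρ : ℝ) (r : Fin q) :
    covMatrix r₀ c ρ r₀ r = c * (q * (if r = r₀ then 1 else 0) - 1) := by
  simp only [covMatrix, Matrix.smul_apply, of_apply, smul_eq_mul]
  by_cases h : r = r₀ <;> simp [h]

lemma covMatrix_ne {q : ℕ} (r₀ : Fin q) (c ρ : ℝ) (j r : Fin q) (hj : j ≠ r₀) :
    covMatrix r₀ c ρ j r = c * ((ρ - 1) * (if r = r₀ then 1 else 0) +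
      (1 + (q - 1) * ρ) * (if r = j then 1 else 0) - ρ) := by
  simp only [covMatrix, Matrix.smul_apply, of_apply, smul_eq_mul]
  by_cases h1 : r = r₀
  · subst h1
    simp [hj, Ne.symm hj]
  · by_cases h2 : r = j
    · subst h2; simp [h1]; left; ring
    · simp [hj, h1, h2, Ne.symm h2]

lemma sum_covMatrix {q : ℕ} (r₀ : Fin q) (c ρ : ℝ) (r : Fin q) : ∑ r', covMatrix r₀ c ρ r r' = 0 := by
  by_cases hr : r = r₀
  · subst hr
    simp_rw [covMatrix_self, ← Finset.mul_sum, Finset.sum_sub_distrib, ← Finset.mul_sum]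
    simp
  · simp_rw [covMatrix_ne _ _ _ _ _ hr, ← Finset.mul_sum, Finset.sum_sub_distrib,
      Finset.sum_add_distrib, ← Finset.mul_sum]
    simp
    right; ring

/-- A matrix with vanishing row and column sums is recovered from the minor that omits `r₀`, since
its remaining entries are minus sums of the others. -/
lemma liftMatrix_mul_mul_transpose {q : ℕ} (r₀ : Fin q) (T : Matrix (Fin q) (Fin q) ℝ)
    (hrow : ∀ r, ∑ r', T r r' = 0) (hcol : ∀ r', ∑ r, T r r' = 0) :
    liftMatrix r₀ * T.submatrix (fun j : {r // r ≠ r₀} => (j : Fin q)) (fun j : {r // r ≠ r₀} => (j : Fin q)) *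
      (liftMatrix r₀)ᵀ = T := by
  have hl : ∀ (r : Fin q) (X : Fin q → ℝ), ∑ r, X r = 0 →
      ∑ j : {r // r ≠ r₀}, liftMatrix r₀ r j * X j = X r := by
    intro r X hX
    rw [sum_eq_add_sum_subtype r₀] at hX
    by_cases hr : r = r₀
    · subst hr
      simp [liftMatrix]
      linarith
    · have := liftMatrix_mulVec_coe r₀ (fun j => X j) ⟨r, hr⟩
      simpa [Matrix.mulVec, dotProduct] using this
  ext r r'
  simp only [mul_apply, transpose_apply, submatrix_apply]
  simp_rw [hl r (fun r => T r _) (hcol _)]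
  simp_rw [mul_comm (T r _)]
  exact hl r' (fun r' => T r r') (hrow r)

/-- It suffices that the minor of `covMatrix` inverts the form. The rank-one part of the form only
sees column sums of the minor, and these all equal `c`, because full columns sum to zero and row
`r₀` contributes `-c`. -/
lemma liftMatrix_mul_inv_mul_transpose {q : ℕ} (hq : 2 ≤ q) (r₀ : Fin q) (D : Fin q → ℝ) (B : ℝ)
    (hD : ∀ r, r ≠ r₀ → D r = B) (hB : 3 ≤ q → B ≠ 0) (h0 : B + (q - 1) * D r₀ ≠ 0) :
    liftMatrix r₀ * (hyperplaneForm r₀ D)⁻¹ * (liftMatrix r₀)ᵀ =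
      covMatrix r₀ (B + (q - 1) * D r₀)⁻¹ (D r₀ / B) := by
  set c := (B + (q - 1) * D r₀)⁻¹ with hc
  set ρ := D r₀ / B with hρ
  have hinv : (hyperplaneForm r₀ D)⁻¹ = (covMatrix r₀ c ρ).submatrix
      (fun j : {r // r ≠ r₀} => (j : Fin q)) (fun j : {r // r ≠ r₀} => (j : Fin q)) := by
    apply Matrix.inv_eq_right_inv
    ext i j
    have hcol : ∑ k : {r // r ≠ r₀}, covMatrix r₀ c ρ k j = c := by
      have h := sum_covMatrix r₀ c ρ j
      simp_rw [covMatrix_symm r₀ c ρ j] at h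
      rw [sum_eq_add_sum_subtype r₀, covMatrix_self, if_neg j.2] at h
      linarith
    simp only [mul_apply, hyperplaneForm, of_apply, submatrix_apply, add_mul, Finset.sum_add_distrib,
      ite_mul, zero_mul, Finset.sum_ite_eq, Finset.mem_univ, if_true, ← Finset.mul_sum, hcol]
    rw [covMatrix_ne _ _ _ _ _ i.2, if_neg j.2, hD i i.2, one_apply]
    rcases hq.eq_or_lt with h2 | hq3
    · have hij : (i : Fin q) = j := by
        have hcard : Fintype.card {r // r ≠ r₀} = 1 := by
          simp [Fintype.card_subtype_compl, ← h2]
        obtain ⟨k, hk⟩ := Fintype.card_eq_one_iff.1 hcard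
        rw [hk i, hk j]
      have hij' : i = j := Subtype.ext hij
      subst hij'
      have : (q : ℝ) = 2 := by exact_mod_cast h2.symm
      rw [this] at hc ⊢ h0
      simp only [if_true]
      rw [hc]
      field_simp
      ring
    · have hB0 := hB hq3
      by_cases hij : i = j
      · subst hij
        simp only [if_true]
        rw [hc, hρ]
        field_simp
        ring
      · have : (j : Fin q) ≠ i := fun h => hij (Subtype.ext h.symm)
        rw [if_neg hij, if_neg this, hc, hρ]
        field_simp
        ring
  rw [hinv]
  refine liftMatrix_mul_mul_transpose r₀ _ (sum_covMatrix r₀ c ρ) fun r' => ?_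
  simp_rw [covMatrix_symm r₀ c ρ _ r']
  exact sum_covMatrix r₀ c ρ r'

end

/-! ### Derivatives of `k` and `f` -/

/-- The derivative of `k`. -/
def kDeriv (p : ℕ) (β x : ℝ) : ℝ := β * p * x ^ (p - 1) - Real.log x - 1

/-- The closed form of the second derivative of `k`. -/
def kDeriv₂ (p : ℕ) (β x : ℝ) : ℝ := β * p * (p - 1) * x ^ (p - 2) - 1 / x

lemma continuous_k (p : ℕ) (β : ℝ) : Continuous (k p β) := by
  have := Real.continuous_mul_log
  unfold k
  fun_prop

lemma hasDerivAt_k (p : ℕ) (β : ℝ) {x : ℝ} (hx : 0 < x) :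
    HasDerivAt (k p β) (kDeriv p β x) x := by
  have h := ((hasDerivAt_pow p x).const_mul β).sub (Real.hasDerivAt_mul_log hx.ne')
  refine h.congr_deriv ?_
  rw [kDeriv]; ring

lemma hasDerivAt_kDeriv {p : ℕ} (hp : 2 ≤ p) (β : ℝ) {x : ℝ} (hx : 0 < x) :
    HasDerivAt (kDeriv p β) (kDeriv₂ p β x) x := by
  have h := (((hasDerivAt_pow (p - 1) x).const_mul (β * p)).sub
    (Real.hasDerivAt_log hx.ne')).sub_const 1
  refine h.congr_deriv ?_
  rw [kDeriv₂, Nat.cast_sub (by omega), show p - 1 - 1 = p - 2 by omega]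
  push_cast
  rw [one_div]; ring

lemma iteratedDeriv_two_eq {g g' : ℝ → ℝ} {g'' x : ℝ} (h1 : ∀ᶠ y in 𝓝 x, HasDerivAt g (g' y) y)
    (h2 : HasDerivAt g' g'' x) : iteratedDeriv 2 g x = g'' := by
  rw [iteratedDeriv_succ, iteratedDeriv_one]
  have : deriv g =ᶠ[𝓝 x] g' := h1.mono fun y hy => hy.deriv
  rw [this.deriv_eq, h2.deriv]

lemma k''_eq {p : ℕ} (hp : 2 ≤ p) (β : ℝ) {x : ℝ} (hx : 0 < x) : k'' p β x = kDeriv₂ p β x :=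
  iteratedDeriv_two_eq ((eventually_gt_nhds hx).mono fun _ hy => hasDerivAt_k p β hy)
    (hasDerivAt_kDeriv hp β hx)

lemma H_eq_sum_k {q : ℕ} [NeZero q] (p : ℕ) (β h : ℝ) (t : Vec q) :
    H p β h t = ∑ r, k p β (t r) + h * t 0 := by
  simp only [H, k, Finset.sum_sub_distrib, Finset.mul_sum]
  ring

lemma continuous_H {q : ℕ} [NeZero q] (p : ℕ) (β h : ℝ) : Continuous (H p β h : Vec q → ℝ) := by
  have := continuous_k p β
  have h1 : (H p β h : Vec q → ℝ) = fun t => ∑ r, k p β (t r) + h * t 0 :=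
    funext (H_eq_sum_k p β h)
  rw [h1]
  fun_prop

lemma f_eq {q : ℕ} [NeZero q] (p : ℕ) (β h s : ℝ) :
    f p q β h s = k p β ((1 + (q - 1) * s) / q) + (q - 1) * k p β ((1 - s) / q) +
      h * ((1 + (q - 1) * s) / q) := by
  have hq : 1 ≤ q := NeZero.one_le
  rw [f, H_eq_sum_k, sum_eq_add_sum_subtype 0]
  have : ∀ j : {r : Fin q // r ≠ 0}, k p β (xvec q s j) = k p β ((1 - s) / q) := fun j => by
    simp [xvec, j.2]
  simp_rw [this]
  simp [xvec, Fintype.card_subtype_compl, Nat.cast_sub hq]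

lemma f''_eq {p q : ℕ} [NeZero q] (hp : 2 ≤ p) (β h : ℝ) {s : ℝ} (ha : 0 < (1 + (q - 1) * s) / q)
    (hb : 0 < (1 - s) / q) : f'' p q β h s =
      (q - 1) / q ^ 2 * ((q - 1) * kDeriv₂ p β ((1 + (q - 1) * s) / q) +
        kDeriv₂ p β ((1 - s) / q)) := by
  have hA : ∀ y : ℝ, HasDerivAt (fun s : ℝ => (1 + ((q : ℝ) - 1) * s) / q) (((q : ℝ) - 1) / q) y := by
    intro y
    have := (((hasDerivAt_id y).const_mul ((q : ℝ) - 1)).const_add 1).div_const (q : ℝ)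
    simpa using this
  have hB : ∀ y : ℝ, HasDerivAt (fun s : ℝ => (1 - s) / (q : ℝ)) (-1 / q) y := by
    intro y
    exact ((hasDerivAt_id y).const_sub 1).div_const (q : ℝ)
  have hf : f p q β h = fun s => k p β ((1 + (q - 1) * s) / q) + (q - 1) * k p β ((1 - s) / q) +
      h * ((1 + (q - 1) * s) / q) := funext (f_eq p β h)
  rw [f'', hf]
  refine iteratedDeriv_two_eq (g' := fun s => kDeriv p β ((1 + (q - 1) * s) / q) * ((q - 1) / q) +
    (q - 1) * (kDeriv p β ((1 - s) / q) * (-1 / q)) + h * ((q - 1) / q)) ?_ ?_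
  · have e1 : ∀ᶠ y in 𝓝 s, 0 < (1 + ((q : ℝ) - 1) * y) / q :=
      (hA s).continuousAt.eventually (eventually_gt_nhds ha)
    have e2 : ∀ᶠ y in 𝓝 s, 0 < (1 - y) / (q : ℝ) :=
      (hB s).continuousAt.eventually (eventually_gt_nhds hb)
    filter_upwards [e1, e2] with y h1 h2
    exact (((hasDerivAt_k p β h1).comp y (hA y)).add
      (((hasDerivAt_k p β h2).comp y (hB y)).const_mul ((q : ℝ) - 1))).add ((hA y).const_mul h)
  · have h1 := ((((hasDerivAt_kDeriv hp β ha).comp s (hA s)).mul_const (((q : ℝ) - 1) / q)).add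
      ((((hasDerivAt_kDeriv hp β hb).comp s (hB s)).mul_const (-1 / (q : ℝ))).const_mul
        ((q : ℝ) - 1))).add_const (h * (((q : ℝ) - 1) / q))
    refine h1.congr_deriv ?_
    ring

/-! ### The shape of the maximizers -/

/-- The vector obtained from `m` by moving the mass `t` from the coordinate `j` to `r`. -/
def moveMass {q : ℕ} (m : Vec q) (r j : Fin q) (t : ℝ) : Vec q :=
  WithLp.toLp 2 fun i => m i + (if i = r then t else 0) - (if i = j then t else 0)

lemma sum_moveMass {q : ℕ} (m : Vec q) (r j : Fin q) (t : ℝ) :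
    ∑ i, moveMass m r j t i = ∑ i, m i := by
  simp [moveMass, Finset.sum_sub_distrib, Finset.sum_add_distrib]

lemma moveMass_mem {q : ℕ} {m : Vec q} (hm : m ∈ probVectors q) {r j : Fin q} {t : ℝ}
    (hr : 0 ≤ m r + t) (hj : 0 ≤ m j - t) (hrj : r ≠ j) : moveMass m r j t ∈ probVectors q := by
  refine ⟨fun i => ?_, by rw [sum_moveMass]; exact hm.2⟩
  have := hm.1 i
  simp only [moveMass]
  by_cases h1 : i = r
  · subst h1; simpa [hrj] using hr
  · by_cases h2 : i = j
    · subst h2; simpa [h1] using hj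
    · simpa [h1, h2] using this

lemma H_moveMass {q : ℕ} [NeZero q] (p : ℕ) (β h : ℝ) (m : Vec q) {r j : Fin q} (hrj : r ≠ j) (t : ℝ) :
    H p β h (moveMass m r j t) = H p β h m + (k p β (m r + t) - k p β (m r)) +
      (k p β (m j - t) - k p β (m j)) +
      h * ((if r = 0 then t else 0) - (if j = 0 then t else 0)) := by
  have h1 : ∑ i, (k p β (moveMass m r j t i) - k p β (m i)) =
      (k p β (m r + t) - k p β (m r)) + (k p β (m j - t) - k p β (m j)) := by
    rw [Fintype.sum_eq_add r j hrj]
    · simp [moveMass, hrj, hrj.symm]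
    · intro i hi
      simp [moveMass, hi.1, hi.2]
  rw [Finset.sum_sub_distrib] at h1
  rw [H_eq_sum_k, H_eq_sum_k]
  have h2 : moveMass m r j t 0 = m 0 + (if r = 0 then t else 0) - (if j = 0 then t else 0) := by
    simp [moveMass, eq_comm]
  rw [h2]
  linear_combination h1

/-- The entropy has infinite slope at 0: moving a small mass `t` to an empty coordinate gains `-t
log t`, while every other change is of order `t`. -/
lemma maximizer_pos {p q : ℕ} [NeZero q] (hp : 2 ≤ p) {β h : ℝ} {m : Vec q}
    (hm : m ∈ maximizers p q β h) (r : Fin q) : 0 < m r := by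
  by_contra hr
  have hr0 : m r = 0 := le_antisymm (not_lt.1 hr) (hm.1.1 r)
  obtain ⟨j, hj⟩ : ∃ j, 0 < m j := by
    by_contra hcon
    push Not at hcon
    have : ∑ i, m i ≤ 0 := Finset.sum_nonpos fun i _ => hcon i
    linarith [hm.1.2]
  have hrj : r ≠ j := by rintro rfl; exact hr hj
  set e : ℝ := (if r = 0 then 1 else 0) - (if j = 0 then 1 else 0) with he
  have hle : ∀ t, 0 < t → t ≤ m j →
      -- This is the increment of `H` under the move, divided by `t`; it tends to `+∞` as `t ↓ 0`,
      -- which contradicts the bound.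
      β * t ^ (p - 1) - Real.log t + t⁻¹ * (k p β (m j - t) - k p β (m j)) + h * e ≤ 0 := by
    intro t ht htj
    have h1 : H p β h (moveMass m r j t) ≤ H p β h m :=
      hm.2 (moveMass_mem hm.1 (by rw [hr0]; linarith) (by linarith) hrj)
    rw [H_moveMass _ _ _ _ hrj, hr0, zero_add] at h1
    have hk0 : k p β 0 = 0 := by simp [k]; omega
    have hkt : k p β t = t * (β * t ^ (p - 1) - Real.log t) := by
      obtain ⟨n, rfl⟩ : ∃ n, p = n + 1 := ⟨p - 1, by omega⟩
      simp [k, pow_succ]; ring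
    have het : (if r = 0 then t else 0) - (if j = 0 then t else 0) = t * e := by
      simp only [he]; split_ifs <;> ring
    rw [hk0, hkt, het] at h1
    have h2 : t * (β * t ^ (p - 1) - Real.log t + t⁻¹ * (k p β (m j - t) - k p β (m j)) + h * e) ≤ 0 := by
      have : t * (t⁻¹ * (k p β (m j - t) - k p β (m j))) = k p β (m j - t) - k p β (m j) := by
        field_simp
      linarith
    exact nonpos_of_mul_nonpos_right h2 ht
  have hd : HasDerivAt (fun t => k p β (m j - t)) (-kDeriv p β (m j)) 0 := by
    have h1 : HasDerivAt (fun t : ℝ => m j - t) (-1) 0 := (hasDerivAt_id (0 : ℝ)).const_sub (m j)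
    have h2 : HasDerivAt (k p β) (kDeriv p β (m j)) (m j - 0) := by
      rw [sub_zero]; exact hasDerivAt_k p β hj
    exact (h2.comp (0 : ℝ) h1).congr_deriv (by ring)
  have hslope : Tendsto (fun t => t⁻¹ * (k p β (m j - t) - k p β (m j))) (𝓝[>] 0)
      (𝓝 (-kDeriv p β (m j))) := by
    have := hd.tendsto_slope_zero_right
    simpa using this
  have hpow : Tendsto (fun t : ℝ => β * t ^ (p - 1)) (𝓝[>] 0) (𝓝 (β * 0 ^ (p - 1))) :=
    ((continuous_const.mul (continuous_pow (p - 1))).tendsto 0).mono_left nhdsWithin_le_nhds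
  have hlog : Tendsto (fun t : ℝ => -Real.log t) (𝓝[>] 0) atTop :=
    tendsto_neg_atBot_atTop.comp Real.tendsto_log_nhdsGT_zero
  have htop := ((hpow.add_atTop hlog).atTop_add hslope).atTop_add
    (tendsto_const_nhds (x := h * e))
  have hev := htop.eventually_gt_atTop 0
  have hev2 : ∀ᶠ t : ℝ in 𝓝[>] 0, t ∈ Set.Ioc 0 (m j) := Ioc_mem_nhdsGT hj
  obtain ⟨t, h1, h2⟩ := (hev.and hev2).exists
  have := hle t h2.1 h2.2
  linarith

/-- The Lagrange condition. All coordinates are positive, so mass can be moved from `j` to `r` in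
both directions, and the derivative of `H` along this move vanishes at a maximizer. -/
lemma maximizer_kDeriv_eq {p q : ℕ} [NeZero q] (hp : 2 ≤ p) {β h : ℝ} {m : Vec q}
    (hm : m ∈ maximizers p q β h) (r j : Fin q) :
    kDeriv p β (m r) + h * (if r = 0 then 1 else 0) =
      kDeriv p β (m j) + h * (if j = 0 then 1 else 0) := by
  by_cases hrj : r = j
  · rw [hrj]
  have hr := maximizer_pos hp hm r
  have hj := maximizer_pos hp hm j
  set e : ℝ := (if r = 0 then 1 else 0) - (if j = 0 then 1 else 0) with he
  set φ : ℝ → ℝ := fun t => k p β (m r + t) + k p β (m j - t) + h * (e * t) with hφ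
  have hmax : IsLocalMax φ 0 := by
    have e1 : ∀ᶠ t : ℝ in 𝓝 0, -m r < t := eventually_gt_nhds (by linarith)
    have e2 : ∀ᶠ t : ℝ in 𝓝 0, t < m j := eventually_lt_nhds hj
    filter_upwards [e1, e2] with t h1 h2
    have h3 : H p β h (moveMass m r j t) ≤ H p β h m :=
      hm.2 (moveMass_mem hm.1 (by linarith) (by linarith) hrj)
    rw [H_moveMass _ _ _ _ hrj] at h3
    have het : (if r = 0 then t else 0) - (if j = 0 then t else 0) = e * t := by
      simp only [he]; split_ifs <;> ring
    rw [het] at h3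
    simp only [hφ, add_zero, sub_zero, mul_zero]
    linarith
  have hd : HasDerivAt φ (kDeriv p β (m r) - kDeriv p β (m j) + h * e) 0 := by
    have h1 : HasDerivAt (fun t : ℝ => m j - t) (-1) 0 := (hasDerivAt_id (0 : ℝ)).const_sub (m j)
    have h2 : HasDerivAt (k p β) (kDeriv p β (m j)) (m j - 0) := by
      rw [sub_zero]; exact hasDerivAt_k p β hj
    have h3 : HasDerivAt (fun t : ℝ => m r + t) 1 0 := (hasDerivAt_id (0 : ℝ)).const_add (m r)
    have h4 : HasDerivAt (k p β) (kDeriv p β (m r)) (m r + 0) := by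
      rw [add_zero]; exact hasDerivAt_k p β hr
    have h5 := ((h4.comp (0 : ℝ) h3).add (h2.comp (0 : ℝ) h1)).add
      (((hasDerivAt_id (0 : ℝ)).const_mul e).const_mul h)
    refine h5.congr_deriv ?_
    ring
  have := hmax.hasDerivAt_eq_zero hd
  rw [he] at this
  linarith

/-- For `β > 0` and `p ≥ 2`, `k''` is a sum of two nondecreasing functions on the positive reals. -/
lemma kDeriv₂_neg_of_le {p : ℕ} (hp : 2 ≤ p) {β : ℝ} (hβ : 0 < β) {x y : ℝ} (hx : 0 < x) (hxy : x ≤ y)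
    (hy : kDeriv₂ p β y < 0) : kDeriv₂ p β x < 0 := by
  have hp' : (2 : ℝ) ≤ p := by exact_mod_cast hp
  have h1 : β * p * (p - 1) * x ^ (p - 2) ≤ β * p * (p - 1) * y ^ (p - 2) := by
    have : 0 ≤ β * p * (p - 1) := mul_nonneg (by positivity) (by linarith)
    gcongr
  have h2 : 1 / y ≤ 1 / x := one_div_le_one_div_of_le hx hxy
  rw [kDeriv₂] at *
  linarith

/-- The form is tested on the difference of two basis vectors. -/
lemma maximizer_kDeriv₂_add_neg {p q : ℕ} {β : ℝ} {m : Vec q}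
    (hQ : ∀ t : Vec q, ∑ r, t r = 0 → t ≠ 0 → Q p β m t < 0) {r j : Fin q} (hrj : r ≠ j) :
    kDeriv₂ p β (m r) + kDeriv₂ p β (m j) < 0 := by
  have h := hQ (moveMass 0 r j 1) (by rw [sum_moveMass]; simp) (fun h0 => by
    have := congrArg (fun t : Vec q => t r) h0
    simp [moveMass, hrj] at this)
  rw [Q, Fintype.sum_eq_add r j hrj] at h
  · simpa [moveMass, hrj, hrj.symm, kDeriv₂] using h
  · intro i hi
    simp [moveMass, hi.1, hi.2]

/-- If `k''` were nonnegative at a coordinate other than the dominant one, it would be so at the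
larger dominant coordinate too, against negativity of their sum. Away from `r₀` the field term is
the same for all coordinates, so `k'` takes equal values there; two different coordinates would by
Rolle give a zero of `k''` below a point where `k''` is negative. -/
lemma maximizer_eq_of_ne {p q : ℕ} [NeZero q] (hp : 2 ≤ p) {β h : ℝ} (hβ : 0 < β) {m : Vec q}
    (hm : m ∈ maximizers p q β h)
    (hQ : ∀ t : Vec q, ∑ r, t r = 0 → t ≠ 0 → Q p β m t < 0) {r₀ : Fin q}
    (hr₀ : ∀ r, m r ≤ m r₀) (h0 : h = 0 ∨ r₀ = 0) {r j : Fin q} (hr : r ≠ r₀) (hj : j ≠ r₀) :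
    m r = m j := by
  have hneg : ∀ i, i ≠ r₀ → kDeriv₂ p β (m i) < 0 := by
    intro i hi
    by_contra hcon
    have h1 := maximizer_kDeriv₂_add_neg hQ hi
    exact hcon (kDeriv₂_neg_of_le hp hβ (maximizer_pos hp hm i) (hr₀ i) (by linarith))
  have heq : kDeriv p β (m r) = kDeriv p β (m j) := by
    have := maximizer_kDeriv_eq hp hm r j
    rcases h0 with rfl | rfl
    · simpa using this
    · simpa [hr, hj] using this
  have hlt : ∀ i i', i' ≠ r₀ → kDeriv p β (m i) = kDeriv p β (m i') → ¬ m i < m i' := by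
    intro i i' hi' he hlt
    have hpos := maximizer_pos hp hm i
    obtain ⟨c, hc, hc0⟩ := exists_hasDerivAt_eq_zero (f := kDeriv p β) (f' := kDeriv₂ p β) hlt
      (fun x hx => (hasDerivAt_kDeriv hp β (hpos.trans_le hx.1)).continuousAt.continuousWithinAt) he
      (fun x hx => hasDerivAt_kDeriv hp β (hpos.trans hx.1))
    exact (kDeriv₂_neg_of_le hp hβ (hpos.trans hc.1) hc.2.le (hneg i' hi')).ne hc0
  exact le_antisymm (not_lt.1 (hlt j r hr heq.symm)) (not_lt.1 (hlt r j hj heq))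

/-- For `h > 0`, exchanging the coordinates `0` and `r` changes `H` only through the field term, so
the coordinate `0` must be a largest one. For `h = 0` any largest coordinate serves. -/
lemma exists_dominant_coordinate {p q : ℕ} [NeZero q] {β h : ℝ} (hh : 0 ≤ h) {m : Vec q}
    (hm : m ∈ maximizers p q β h) : ∃ r₀, (∀ r, m r ≤ m r₀) ∧ (h = 0 ∨ r₀ = 0) := by
  rcases hh.eq_or_lt with rfl | hpos
  · obtain ⟨r₀, hr₀⟩ := Finite.exists_max fun r => m r
    exact ⟨r₀, hr₀, Or.inl rfl⟩
  · refine ⟨0, fun r => ?_, Or.inr rfl⟩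
    set t : Vec q := WithLp.toLp 2 fun i => m (Equiv.swap 0 r i) with ht
    have hsum : ∀ g : ℝ → ℝ, ∑ i, g (t i) = ∑ i, g (m i) := fun g =>
      Equiv.sum_comp (Equiv.swap 0 r) fun i => g (m i)
    have h1 : H p β h t ≤ H p β h m :=
      hm.2 ⟨fun i => hm.1.1 _, (hsum fun x => x).trans hm.1.2⟩
    rw [H_eq_sum_k, H_eq_sum_k, hsum] at h1
    have h2 : t 0 = m r := by simp [ht]
    rw [h2] at h1
    exact le_of_mul_le_mul_left (by linarith) hpos

lemma permMatrix_mulVec_apply {q : ℕ} (σ : Equiv.Perm (Fin q)) (x : Vec q) (r : Fin q) :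
    mulVec (σ.permMatrix ℝ) x r = x (σ r) := by
  simp [mulVec, Matrix.permMatrix_mulVec]

lemma maximizer_eq_permMatrix_mulVec_xvec {p q : ℕ} [NeZero q] (hp : 2 ≤ p) (hq : 2 ≤ q) {β h : ℝ}
    (hβ : 0 < β) (hh : 0 ≤ h) {m : Vec q} (hm : m ∈ maximizers p q β h)
    (hQ : ∀ t : Vec q, ∑ r, t r = 0 → t ≠ 0 → Q p β m t < 0) :
    ∃ s : ℝ, 0 ≤ s ∧ s < 1 ∧ ∃ σ : Equiv.Perm (Fin q), m = mulVec (σ.permMatrix ℝ) (xvec q s) := by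
  obtain ⟨r₀, hr₀, h0⟩ := exists_dominant_coordinate hh hm
  have : Nontrivial (Fin q) := Fin.nontrivial_iff_two_le.2 hq
  obtain ⟨j, hj⟩ := exists_ne r₀
  have hall : ∀ r, r ≠ r₀ → m r = m j := fun r hr => maximizer_eq_of_ne hp hβ hm hQ hr₀ h0 hr hj
  have hq0 : (0 : ℝ) < q := by positivity
  have hsum : m r₀ + (q - 1) * m j = 1 := by
    have := hm.1.2
    rw [sum_eq_add_sum_subtype r₀, Finset.sum_congr rfl fun (i : {r // r ≠ r₀}) _ => hall i i.2] at this
    simpa [Fintype.card_subtype_compl, Nat.cast_sub (show 1 ≤ q by omega)] using this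
  -- The value of `s` solves `(1 - s) / q = m j`. It is nonnegative because `m j` is at most the
  -- average `1 / q`, and less than 1 because `m j` is positive.
  refine ⟨1 - q * m j, ?_, ?_, Equiv.swap r₀ 0, ?_⟩
  · have := hr₀ j; linarith
  · have := mul_pos hq0 (maximizer_pos hp hm j); linarith
  · ext r
    rw [permMatrix_mulVec_apply]
    by_cases hr : r = r₀
    · subst hr
      simp only [Equiv.swap_apply_left, xvec, if_true]
      rw [eq_div_iff hq0.ne']
      linear_combination (q : ℝ) * hsum
    · have : Equiv.swap r₀ 0 r ≠ 0 := by
        intro h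
        apply hr
        have := congrArg (Equiv.swap r₀ 0) h
        simpa using this
      simp only [xvec, if_neg this]
      rw [hall r hr]
      field_simp
      ring

/-! ### Second-order behaviour of `H` at a maximizer -/

/-- The derivative of the remainder is `o(x)`, so the mean value inequality on the interval of
radius `|x|` bounds the remainder by `o(x) |x|`. The second derivative is needed at `x₀` only. -/
lemma taylor_two_isLittleO {g g' : ℝ → ℝ} {g'' x₀ : ℝ} (h1 : ∀ᶠ y in 𝓝 x₀, HasDerivAt g (g' y) y)
    (h2 : HasDerivAt g' g'' x₀) :
    (fun x => g (x₀ + x) - g x₀ - g' x₀ * x - g'' / 2 * x ^ 2) =o[𝓝 0] fun x => x ^ 2 := by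
  set R : ℝ → ℝ := fun x => g (x₀ + x) - g x₀ - g' x₀ * x - g'' / 2 * x ^ 2 with hR
  set R' : ℝ → ℝ := fun x => g' (x₀ + x) - g' x₀ - g'' * x with hR'
  have ht : Tendsto (fun x : ℝ => x₀ + x) (𝓝 0) (𝓝 x₀) := by
    have : Tendsto (fun x : ℝ => x₀ + x) (𝓝 0) (𝓝 (x₀ + 0)) :=
      (continuous_const.add continuous_id).tendsto 0
    rwa [add_zero] at this
  have hd : ∀ᶠ x in 𝓝 (0 : ℝ), HasDerivAt R (R' x) x := by
    filter_upwards [ht.eventually h1] with x hx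
    have h3 : HasDerivAt (fun x : ℝ => x₀ + x) 1 x := (hasDerivAt_id x).const_add x₀
    have h4 := (((hx.comp x h3).sub_const (g x₀)).sub ((hasDerivAt_id x).const_mul (g' x₀))).sub
      ((hasDerivAt_pow 2 x).const_mul (g'' / 2))
    refine h4.congr_deriv ?_
    simp only [hR']
    push_cast
    ring
  have ho := hasDerivAt_iff_isLittleO_nhds_zero.1 h2
  rw [Asymptotics.isLittleO_iff] at ho ⊢
  intro c hc
  obtain ⟨δ, hδ, hball⟩ := Metric.eventually_nhds_iff_ball.1 (hd.and (ho hc))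
  refine Metric.eventually_nhds_iff_ball.2 ⟨δ, hδ, fun x hx => ?_⟩
  have hx' : |x| < δ := by simpa using hx
  have hR0 : R 0 = 0 := by simp [hR]
  have hsub : ∀ y ∈ Metric.closedBall (0 : ℝ) |x|, y ∈ Metric.ball (0 : ℝ) δ := fun y hy =>
    Metric.closedBall_subset_ball hx' hy
  have := (convex_closedBall (0 : ℝ) |x|).norm_image_sub_le_of_norm_hasDerivWithin_le (f := R)
    (f' := R') (C := c * |x|) (x := 0) (y := x)
    (fun y hy => (hball y (hsub y hy)).1.hasDerivWithinAt) (fun y hy => by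
      have h3 := (hball y (hsub y hy)).2
      have h4 : R' y = g' (x₀ + y) - g' x₀ - y • g'' := by simp [hR', mul_comm]
      rw [h4]
      refine h3.trans ?_
      have : |y| ≤ |x| := by simpa using hy
      rw [Real.norm_eq_abs]
      gcongr) (by simp) (by simp)
  rw [hR0, sub_zero, sub_zero, Real.norm_eq_abs x] at this
  calc ‖R x‖ ≤ c * |x| * |x| := this
    _ = c * ‖x ^ 2‖ := by rw [norm_pow, Real.norm_eq_abs]; ring

lemma k_taylor_isLittleO {p : ℕ} (hp : 2 ≤ p) (β : ℝ) {x : ℝ} (hx : 0 < x) :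
    (fun y => k p β (x + y) - k p β x - kDeriv p β x * y - kDeriv₂ p β x / 2 * y ^ 2)
      =o[𝓝 0] fun y => y ^ 2 :=
  taylor_two_isLittleO ((eventually_gt_nhds hx).mono fun _ hy => hasDerivAt_k p β hy)
    (hasDerivAt_kDeriv hp β hx)

lemma Q_eq {q : ℕ} (p : ℕ) (β : ℝ) (m t : Vec q) : Q p β m t = ∑ r, kDeriv₂ p β (m r) * t r ^ 2 := rfl

/-- At a maximizer, the increment of `H` is its second order Taylor term plus the remainders of `k`. -/
lemma H_add_sub_eq {p q : ℕ} [NeZero q] (hp : 2 ≤ p) {β h : ℝ} {m : Vec q}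
    (hm : m ∈ maximizers p q β h) (x : Vec q) (hx : ∑ r, x r = 0) :
    H p β h (m + x) - H p β h m = Q p β m x / 2 + ∑ r, (k p β (m r + x r) - k p β (m r) -
      kDeriv p β (m r) * x r - kDeriv₂ p β (m r) / 2 * x r ^ 2) := by
  -- By the Lagrange condition the gradient is a constant vector, hence orthogonal to the zero-sum
  -- vector `x`.
  have h1 : ∑ r, (kDeriv p β (m r) + h * (if r = 0 then 1 else 0)) * x r = 0 := by
    rw [Finset.sum_congr rfl fun r _ => by rw [maximizer_kDeriv_eq hp hm r 0], ← Finset.mul_sum, hx,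
      mul_zero]
  have h2 : ∑ r, h * (if r = 0 then 1 else 0) * x r = h * x 0 := by
    simp
  simp only [add_mul, Finset.sum_add_distrib, h2] at h1
  rw [H_eq_sum_k, H_eq_sum_k, Q_eq]
  simp only [Finset.sum_sub_distrib, PiLp.add_apply]
  have h3 : ∑ r, kDeriv₂ p β (m r) / 2 * x r ^ 2 = (∑ r, kDeriv₂ p β (m r) * x r ^ 2) / 2 := by
    rw [Finset.sum_div]
    exact Finset.sum_congr rfl fun r _ => by ring
  rw [h3]
  linear_combination h1

lemma continuous_Q {q : ℕ} (p : ℕ) (β : ℝ) (m : Vec q) : Continuous (Q p β m) := by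
  unfold Q
  fun_prop

/-- Compactness of the unit sphere of the hyperplane and homogeneity of degree two. -/
lemma exists_Q_le {p q : ℕ} {β : ℝ} {m : Vec q}
    (hQ : ∀ t : Vec q, ∑ r, t r = 0 → t ≠ 0 → Q p β m t < 0) :
    ∃ c : ℝ, 0 < c ∧ ∀ t : Vec q, ∑ r, t r = 0 → Q p β m t ≤ -c * ‖t‖ ^ 2 := by
  set S : Set (Vec q) := Metric.sphere 0 1 ∩ {t | ∑ r, t r = 0} with hS
  have hcomp : IsCompact S := (isCompact_sphere 0 1).inter_right
    (isClosed_eq (by fun_prop) continuous_const)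
  have hmain : ∃ c : ℝ, 0 < c ∧ ∀ t ∈ S, Q p β m t ≤ -c := by
    rcases S.eq_empty_or_nonempty with h0 | hne
    · exact ⟨1, one_pos, fun t ht => by rw [h0] at ht; exact ht.elim⟩
    · obtain ⟨t₀, ht₀, hmax⟩ := hcomp.exists_isMaxOn hne (continuous_Q p β m).continuousOn
      refine ⟨-Q p β m t₀, ?_, fun t ht => by rw [neg_neg]; exact hmax ht⟩
      have : t₀ ≠ 0 := by
        rintro rfl
        simpa using ht₀.1
      linarith [hQ t₀ ht₀.2 this]
  obtain ⟨c, hc, hle⟩ := hmain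
  refine ⟨c, hc, fun t ht => ?_⟩
  by_cases h0 : t = 0
  · simp [h0, Q]
  have hn : 0 < ‖t‖ := norm_pos_iff.2 h0
  have h1 := hle (‖t‖⁻¹ • t) ⟨by simp [norm_smul, hn.ne'], by
    simp only [Set.mem_ofPred_eq, PiLp.smul_apply, smul_eq_mul, ← Finset.mul_sum, ht, mul_zero]⟩
  have h2 : Q p β m (‖t‖⁻¹ • t) = (‖t‖ ^ 2)⁻¹ * Q p β m t := by
    rw [Q_eq, Q_eq, Finset.mul_sum]
    refine Finset.sum_congr rfl fun r _ => ?_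
    simp only [PiLp.smul_apply, smul_eq_mul, mul_pow, inv_pow]
    ring
  rw [h2, inv_mul_le_iff₀ (by positivity)] at h1
  linarith

lemma abs_apply_le_norm {q : ℕ} (x : Vec q) (r : Fin q) : |x r| ≤ ‖x‖ := by
  simpa using PiLp.norm_apply_le x r

lemma exists_H_sub_le_local {p q : ℕ} [NeZero q] (hp : 2 ≤ p) {β h : ℝ} {m : Vec q}
    (hm : m ∈ maximizers p q β h)
    (hQ : ∀ t : Vec q, ∑ r, t r = 0 → t ≠ 0 → Q p β m t < 0) :
    ∃ c δ : ℝ, 0 < c ∧ 0 < δ ∧ ∀ t ∈ probVectors q, ‖t - m‖ < δ →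
      H p β h t - H p β h m ≤ -c * ‖t - m‖ ^ 2 := by
  obtain ⟨c, hc, hle⟩ := exists_Q_le hQ
  have hev : ∀ r : Fin q, ∀ᶠ y in 𝓝 (0 : ℝ), ‖k p β (m r + y) - k p β (m r) - kDeriv p β (m r) * y -
      kDeriv₂ p β (m r) / 2 * y ^ 2‖ ≤ c / 4 * ‖y ^ 2‖ := fun r =>
    (Asymptotics.isLittleO_iff.1 (k_taylor_isLittleO hp β (maximizer_pos hp hm r))) (by positivity)
  obtain ⟨δ, hδ, hball⟩ := Metric.eventually_nhds_iff_ball.1 (eventually_all.2 hev)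
  -- The quadratic term is at most `-c/2 ‖t - m‖²` and the Taylor remainders cost at most `c/4 ‖t -
  -- m‖²`.
  refine ⟨c / 4, δ, by positivity, hδ, fun t ht htm => ?_⟩
  have hsum : ∑ r, (t - m) r = 0 := by
    simp [Finset.sum_sub_distrib, ht.2, hm.1.2]
  have h1 := H_add_sub_eq hp hm (t - m) hsum
  rw [add_sub_cancel] at h1
  rw [h1]
  have h2 : ∑ r, (k p β (m r + (t - m) r) - k p β (m r) - kDeriv p β (m r) * (t - m) r -
      kDeriv₂ p β (m r) / 2 * (t - m) r ^ 2) ≤ ∑ r, c / 4 * (t - m) r ^ 2 := by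
    refine Finset.sum_le_sum fun r _ => ?_
    have h3 := hball ((t - m) r) (by simpa using (abs_apply_le_norm (t - m) r).trans_lt htm) r
    rw [Real.norm_of_nonneg (sq_nonneg _)] at h3
    exact (le_abs_self _).trans h3
  rw [← Finset.mul_sum, ← EuclideanSpace.real_norm_sq_eq] at h2
  have h3 := hle (t - m) hsum
  linarith

lemma isCompact_probVectors (q : ℕ) : IsCompact (probVectors q) := by
  refine Metric.isCompact_of_isClosed_isBounded ?_ ?_
  · have : probVectors q = (⋂ r, {t : Vec q | 0 ≤ t r}) ∩ {t | ∑ r, t r = 1} := by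
      ext t; simp [probVectors]
    rw [this]
    exact (isClosed_iInter fun r => isClosed_le continuous_const (by fun_prop)).inter
      (isClosed_eq (by fun_prop) continuous_const)
  · refine (Metric.isBounded_iff_subset_closedBall 0).2 ⟨√q, fun t ht => ?_⟩
    have h1 : ∀ r, t r ≤ 1 := fun r => by
      rw [← ht.2]; exact Finset.single_le_sum (fun i _ => ht.1 i) (Finset.mem_univ r)
    rw [mem_closedBall_zero_iff, EuclideanSpace.norm_eq]
    refine Real.sqrt_le_sqrt ?_
    calc ∑ r, ‖t r‖ ^ 2 ≤ ∑ r : Fin q, (1 : ℝ) := Finset.sum_le_sum fun r _ => by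
          rw [Real.norm_of_nonneg (ht.1 r)]; exact pow_le_one₀ (ht.1 r) (h1 r)
      _ = q := by simp

lemma H_eq_of_maximizers {p q : ℕ} [NeZero q] {β h : ℝ} {m m' : Vec q} (hm : m ∈ maximizers p q β h)
    (hm' : m' ∈ maximizers p q β h) : H p β h m = H p β h m' :=
  le_antisymm (hm'.2 hm.1) (hm.2 hm'.1)

/-- Infinitely many maximizers would accumulate in the compact simplex. By continuity the
accumulation point is a maximizer, but quadratic decay isolates it. -/
lemma finite_maximizers {p q : ℕ} [NeZero q] (hp : 2 ≤ p) {β h : ℝ} 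
    (hQ : ∀ m ∈ maximizers p q β h, ∀ t : Vec q, ∑ r, t r = 0 → t ≠ 0 → Q p β m t < 0) :
    (maximizers p q β h).Finite := by
  by_contra hinf
  obtain ⟨m, hmP, hacc⟩ := Set.Infinite.exists_accPt_of_subset_isCompact (s := maximizers p q β h)
    hinf (isCompact_probVectors q) (fun m hm => hm.1)
  rw [accPt_iff_frequently] at hacc
  obtain ⟨m₀, hm₀⟩ := Set.Infinite.nonempty hinf
  have hm : m ∈ maximizers p q β h := by
    have hcl : m ∈ closure (maximizers p q β h) :=
      mem_closure_iff_frequently.2 (hacc.mono fun y hy => hy.2)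
    have hsub : closure (maximizers p q β h) ⊆ {t | H p β h t = H p β h m₀} :=
      closure_minimal (fun t ht => H_eq_of_maximizers ht hm₀)
        (isClosed_eq (continuous_H p β h) continuous_const)
    refine ⟨hmP, fun t ht => ?_⟩
    have : H p β h m = H p β h m₀ := hsub hcl
    simp only [Set.mem_ofPred_eq, this]
    exact hm₀.2 ht
  obtain ⟨c, δ, hc, hδ, hle⟩ := exists_H_sub_le_local hp hm (hQ m hm)
  obtain ⟨y, hy, hyδ⟩ := (hacc.and_eventually (Metric.ball_mem_nhds m hδ)).exists
  have h1 := hle y hy.2.1 (by rwa [← dist_eq_norm])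
  rw [H_eq_of_maximizers hy.2 hm, sub_self] at h1
  have : 0 < ‖y - m‖ := norm_pos_iff.2 (sub_ne_zero.2 hy.1)
  have : 0 < c * ‖y - m‖ ^ 2 := by positivity
  linarith

/-- Close to `m` this is the local decay. In the rest of the closed ball there is no other
maximizer, so compactness gives a uniform deficit `η`, which is at least `η / ε²` times the squared
distance. -/
lemma exists_H_sub_le {p q : ℕ} [NeZero q] (hp : 2 ≤ p) {β h : ℝ} {m : Vec q}
    (hm : m ∈ maximizers p q β h)
    (hQ : ∀ t : Vec q, ∑ r, t r = 0 → t ≠ 0 → Q p β m t < 0) {ε : ℝ} (hε : 0 < ε)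
    (huniq : ∀ m' ∈ maximizers p q β h, m' ≠ m → ε < dist m m') :
    ∃ c : ℝ, 0 < c ∧ ∀ t ∈ probVectors q, ‖t - m‖ ≤ ε → H p β h t - H p β h m ≤ -c * ‖t - m‖ ^ 2 := by
  obtain ⟨c, δ, hc, hδ, hle⟩ := exists_H_sub_le_local hp hm hQ
  set S : Set (Vec q) := probVectors q ∩ {t | δ ≤ ‖t - m‖ ∧ ‖t - m‖ ≤ ε} with hS
  have hnorm : Continuous fun t : Vec q => ‖t - m‖ := by fun_prop
  have hcomp : IsCompact S := (isCompact_probVectors q).inter_right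
    (isClosed_Icc.preimage hnorm)
  rcases S.eq_empty_or_nonempty with h0 | hne
  · refine ⟨c, hc, fun t ht htε => hle t ht ?_⟩
    by_contra hcon
    have : t ∈ S := ⟨ht, not_lt.1 hcon, htε⟩
    rw [h0] at this
    exact this
  · obtain ⟨t₀, ht₀, hmax⟩ := hcomp.exists_isMaxOn hne (continuous_H p β h).continuousOn
    have hlt : H p β h t₀ < H p β h m := by
      refine lt_of_le_of_ne (hm.2 ht₀.1) fun heq => ?_
      have hmem : t₀ ∈ maximizers p q β h := ⟨ht₀.1, fun t ht => by
        simp only [Set.mem_ofPred_eq, heq]; exact hm.2 ht⟩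
      have hne' : t₀ ≠ m := by
        rintro rfl
        have := ht₀.2.1
        simp at this
        linarith
      have h1 := huniq t₀ hmem hne'
      rw [dist_comm, dist_eq_norm] at h1
      linarith [ht₀.2.2]
    set η := H p β h m - H p β h t₀ with hη
    have hηpos : 0 < η := by linarith
    refine ⟨min c (η / ε ^ 2), lt_min hc (by positivity), fun t ht htε => ?_⟩
    rcases lt_or_ge ‖t - m‖ δ with hlt' | hge
    · refine (hle t ht hlt').trans ?_
      have : min c (η / ε ^ 2) * ‖t - m‖ ^ 2 ≤ c * ‖t - m‖ ^ 2 := by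
        gcongr; exact min_le_left _ _
      linarith
    · have h1 : H p β h t ≤ H p β h t₀ := hmax ⟨ht, hge, htε⟩
      have h2 : min c (η / ε ^ 2) * ‖t - m‖ ^ 2 ≤ η / ε ^ 2 * ε ^ 2 := by
        gcongr; exact min_le_right _ _
      rw [div_mul_cancel₀ _ (by positivity)] at h2
      linarith

lemma tendsto_mul_H_sub {p q : ℕ} [NeZero q] (hp : 2 ≤ p) {β h : ℝ} {m : Vec q}
    (hm : m ∈ maximizers p q β h) {W : ℕ → Vec q} {w : Vec q} (hW : Tendsto W atTop (𝓝 w))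
    (hsum : ∀ᶠ N in atTop, ∑ r, W N r = 0) :
    Tendsto (fun N : ℕ => (N : ℝ) * (H p β h (m + (√(N : ℝ))⁻¹ • W N) - H p β h m)) atTop
      (𝓝 (Q p β m w / 2)) := by
  have hWr : ∀ r, Tendsto (fun N => W N r) atTop (𝓝 (w r)) := fun r =>
    ((continuous_apply r).comp (PiLp.continuous_ofLp 2 _)).continuousAt.tendsto.comp hW
  have hinv : Tendsto (fun N : ℕ => (√(N : ℝ))⁻¹) atTop (𝓝 0) :=
    tendsto_inv_atTop_zero.comp (Real.tendsto_sqrt_atTop.comp tendsto_natCast_atTop_atTop)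
  have hx : ∀ r, Tendsto (fun N : ℕ => (√(N : ℝ))⁻¹ * W N r) atTop (𝓝 0) := fun r => by
    simpa using hinv.mul (hWr r)
  have hrem : ∀ r, Tendsto (fun N : ℕ => (N : ℝ) * (k p β (m r + (√(N : ℝ))⁻¹ * W N r) - k p β (m r) -
      kDeriv p β (m r) * ((√(N : ℝ))⁻¹ * W N r) -
      kDeriv₂ p β (m r) / 2 * ((√(N : ℝ))⁻¹ * W N r) ^ 2)) atTop (𝓝 0) := by
    intro r
    have h1 := (k_taylor_isLittleO hp β (maximizer_pos hp hm r)).comp_tendsto (hx r)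
    have h2 := (Asymptotics.isBigO_refl (fun N : ℕ => (N : ℝ)) atTop).mul_isLittleO h1
    have h3 : (fun N : ℕ => (N : ℝ) * ((fun y : ℝ => y ^ 2) ∘ fun N : ℕ => (√(N : ℝ))⁻¹ * W N r) N)
        =ᶠ[atTop] fun N => W N r ^ 2 := by
      filter_upwards [eventually_gt_atTop 0] with N hN
      have : (0 : ℝ) < N := by positivity
      simp only [Function.comp_apply, mul_pow, inv_pow, Real.sq_sqrt this.le]
      field_simp
    have h4 : (fun N => W N r ^ 2) =O[atTop] fun _ => (1 : ℝ) :=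
      ((hWr r).pow 2).isBigO_one ℝ
    exact (Asymptotics.isLittleO_one_iff ℝ).1 ((h2.congr' EventuallyEq.rfl h3).trans_isBigO h4)
  have hQt : Tendsto (fun N => Q p β m (W N) / 2) atTop (𝓝 (Q p β m w / 2)) :=
    (((continuous_Q p β m).tendsto w).comp hW).div_const 2
  have hall := hQt.add (tendsto_finsetSum Finset.univ fun r _ => hrem r)
  simp only [Finset.sum_const_zero, add_zero] at hall
  refine hall.congr' ?_
  filter_upwards [eventually_gt_atTop 0, hsum] with N hN hs
  have hNpos : (0 : ℝ) < N := by positivity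
  rw [H_add_sub_eq hp hm, mul_add, Finset.mul_sum]
  · congr 1
    rw [Q_eq, Q_eq, mul_div_assoc', Finset.mul_sum]
    congr 1
    refine Finset.sum_congr rfl fun r _ => ?_
    simp only [PiLp.smul_apply, smul_eq_mul, mul_pow, inv_pow, Real.sq_sqrt hNpos.le]
    field_simp
  · simp only [PiLp.smul_apply, smul_eq_mul, ← Finset.mul_sum, hs, mul_zero]

/-! ### Lattice points near a maximizer -/

open Matrix in
/-- The zero-sum vector whose coordinates other than `r₀` are given. -/
def zeroSumLift {q : ℕ} (r₀ : Fin q) (w : {r // r ≠ r₀} → ℝ) : Vec q :=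
  WithLp.toLp 2 (liftMatrix r₀ *ᵥ w)

/-- The point of the lattice of proportions whose coordinates other than `r₀` are those of
`m + w / √N` rounded down. -/
def latticeProportions {q : ℕ} (r₀ : Fin q) (N : ℕ) (m : Vec q) (w : {r // r ≠ r₀} → ℝ) : Vec q :=
  WithLp.toLp 2 fun r => (latticePoint r₀ N (fun j => ⌊N * m j + √N * w j⌋) r : ℝ) / N

/-- The rescaled deviation from `m` of the lattice point `latticeProportions`. -/
def latticeDeviation {q : ℕ} (r₀ : Fin q) (N : ℕ) (m : Vec q) (w : {r // r ≠ r₀} → ℝ) : Vec q :=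
  √(N : ℝ) • (latticeProportions r₀ N m w - m)

lemma add_smul_latticeDeviation {q : ℕ} (r₀ : Fin q) {N : ℕ} (hN : N ≠ 0) (m : Vec q)
    (w : {r // r ≠ r₀} → ℝ) :
    m + (√(N : ℝ))⁻¹ • latticeDeviation r₀ N m w = latticeProportions r₀ N m w := by
  have : √(N : ℝ) ≠ 0 := by positivity
  rw [latticeDeviation, smul_smul, inv_mul_cancel₀ this, one_smul, add_sub_cancel]

lemma sum_latticeProportions {q : ℕ} (r₀ : Fin q) {N : ℕ} (hN : N ≠ 0) (m : Vec q)
    (w : {r // r ≠ r₀} → ℝ) : ∑ r, latticeProportions r₀ N m w r = 1 := by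
  have h := sum_latticePoint r₀ N (fun j => ⌊N * m j + √N * w j⌋)
  simp only [latticeProportions]
  rw [← Finset.sum_div, ← Int.cast_sum, h, Int.cast_natCast]
  exact div_self (by positivity)

lemma sum_latticeDeviation {q : ℕ} (r₀ : Fin q) {N : ℕ} (hN : N ≠ 0) {m : Vec q}
    (hm : ∑ r, m r = 1) (w : {r // r ≠ r₀} → ℝ) : ∑ r, latticeDeviation r₀ N m w r = 0 := by
  simp only [latticeDeviation, PiLp.smul_apply, PiLp.sub_apply, smul_eq_mul]
  rw [← Finset.mul_sum, Finset.sum_sub_distrib, sum_latticeProportions r₀ hN, hm, sub_self, mul_zero]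

lemma abs_latticeDeviation_sub_le {q : ℕ} (r₀ : Fin q) {N : ℕ} (hN : N ≠ 0) (m : Vec q)
    (w : {r // r ≠ r₀} → ℝ) (j : {r // r ≠ r₀}) :
    |latticeDeviation r₀ N m w j - w j| ≤ (√(N : ℝ))⁻¹ := by
  have hpos : 0 < √(N : ℝ) := by positivity
  have hN0 : (0 : ℝ) < N := by positivity
  set u : ℝ := N * m j + √N * w j with hu
  have h1 : latticeDeviation r₀ N m w j - w j = (⌊u⌋ - u) * (√(N : ℝ))⁻¹ := by
    have h2 : latticeProportions r₀ N m w j = (⌊u⌋ : ℝ) / N := by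
      simp [latticeProportions, latticePoint, j.2, hu]
    simp only [latticeDeviation, PiLp.smul_apply, PiLp.sub_apply, smul_eq_mul, h2]
    rw [hu]
    have hs : √(N : ℝ) * √N = N := Real.mul_self_sqrt hN0.le
    field_simp
    linear_combination (⌊(N : ℝ) * m j + √N * w j⌋ - (N : ℝ) * m j) * hs
  rw [h1, abs_mul, abs_of_pos (inv_pos.2 hpos)]
  refine mul_le_of_le_one_left (inv_pos.2 hpos).le ?_
  rw [abs_le]
  constructor
  · linarith [Int.lt_floor_add_one u]
  · linarith [Int.floor_le u]

lemma tendsto_inv_sqrt_natCast : Tendsto (fun N : ℕ => (√(N : ℝ))⁻¹) atTop (𝓝 0) :=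
  tendsto_inv_atTop_zero.comp (Real.tendsto_sqrt_atTop.comp tendsto_natCast_atTop_atTop)

lemma tendsto_vec_iff {q : ℕ} {W : ℕ → Vec q} {w : Vec q} :
    Tendsto W atTop (𝓝 w) ↔ ∀ r, Tendsto (fun N => W N r) atTop (𝓝 (w r)) := by
  rw [(PiLp.homeomorph 2 (fun _ : Fin q => ℝ)).isInducing.tendsto_nhds_iff, tendsto_pi_nhds]
  rfl

/-- Each free coordinate is within `1/√N` of its target; the coordinate `r₀`, which collects the
rounding errors, is forced by the zero sum. -/
lemma tendsto_latticeDeviation {q : ℕ} (r₀ : Fin q) {m : Vec q} (hm : ∑ r, m r = 1)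
    (w : {r // r ≠ r₀} → ℝ) :
    Tendsto (fun N => latticeDeviation r₀ N m w) atTop (𝓝 (zeroSumLift r₀ w)) := by
  have hj : ∀ j : {r // r ≠ r₀}, Tendsto (fun N => latticeDeviation r₀ N m w j) atTop (𝓝 (w j)) := by
    intro j
    rw [tendsto_iff_dist_tendsto_zero]
    refine squeeze_zero' (Eventually.of_forall fun _ => dist_nonneg) ?_ tendsto_inv_sqrt_natCast
    filter_upwards [eventually_ne_atTop 0] with N hN
    exact abs_latticeDeviation_sub_le r₀ hN m w j
  rw [tendsto_vec_iff]
  intro r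
  by_cases hr : r = r₀
  · subst hr
    have h1 := (tendsto_finsetSum Finset.univ fun j _ => hj j).neg
    simp only [zeroSumLift, liftMatrix_mulVec_self]
    refine h1.congr' ?_
    filter_upwards [eventually_ne_atTop 0] with N hN
    have h2 := sum_latticeDeviation r hN hm w
    rw [sum_eq_add_sum_subtype r] at h2
    linarith
  · have := liftMatrix_mulVec_coe r₀ w ⟨r, hr⟩
    simp only [zeroSumLift]
    rw [this]
    exact hj ⟨r, hr⟩

lemma tendsto_sqrt_mul_sub {g : ℝ → ℝ} {g' a : ℝ} (hg : HasDerivAt g g' a) {W : ℕ → ℝ} {w : ℝ}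
    (hW : Tendsto W atTop (𝓝 w)) :
    Tendsto (fun N : ℕ => √(N : ℝ) * (g (a + (√(N : ℝ))⁻¹ * W N) - g a)) atTop (𝓝 (g' * w)) := by
  have hx : Tendsto (fun N : ℕ => (√(N : ℝ))⁻¹ * W N) atTop (𝓝 0) := by
    simpa using tendsto_inv_sqrt_natCast.mul hW
  have h1 := (hasDerivAt_iff_isLittleO_nhds_zero.1 hg).comp_tendsto hx
  have h2 := (Asymptotics.isBigO_refl (fun N : ℕ => √(N : ℝ)) atTop).mul_isLittleO h1
  have hev : ∀ᶠ N : ℕ in atTop, √(N : ℝ) ≠ 0 := by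
    filter_upwards [eventually_ne_atTop 0] with N hN
    positivity
  have h3 : (fun N : ℕ => √(N : ℝ) * ((fun y : ℝ => y) ∘ fun N : ℕ => (√(N : ℝ))⁻¹ * W N) N)
      =ᶠ[atTop] W := by
    filter_upwards [hev] with N hN
    simp only [Function.comp_apply]
    field_simp
  have h5 := (Asymptotics.isLittleO_one_iff ℝ).1 ((h2.congr' EventuallyEq.rfl h3).trans_isBigO
    (hW.isBigO_one ℝ))
  have h6 := h5.add (hW.const_mul g')
  rw [zero_add] at h6
  refine h6.congr' ?_
  filter_upwards [hev] with N hN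
  simp only [Function.comp_apply, smul_eq_mul]
  field_simp
  ring

/-! ### Pointwise limit and domination of the rescaled summand -/

/-- The logarithm of the normalized weight of a magnetization vector, up to the entropy. -/
def energyExponent {q : ℕ} [NeZero q] (p N : ℕ) (β h β' h' : ℝ) (m t : Vec q) : ℝ :=
  N * (H p β h t - H p β h m) + √(N : ℝ) * (β' * (∑ r, t r ^ p - ∑ r, m r ^ p) + h' * (t 0 - m 0))

/-- The logarithm of the normalization near the maximizer `m`. -/
def logNormalization {q : ℕ} [NeZero q] (p N : ℕ) (β h β' h' : ℝ) (m : Vec q) : ℝ :=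
  N * H p β h m + √(N : ℝ) * (β' * ∑ r, m r ^ p + h' * m 0)

/-- The Stirling prefactor of a multinomial coefficient. -/
def stirlingPrefactor {q : ℕ} (N : ℕ) (n : Fin q → ℕ) : ℝ :=
  √(N : ℝ) ^ (q - 1) * (stirlingFactor N / ∏ r, stirlingFactor (n r))

/-- Since `N / √N = √N`, the perturbation of the parameters separates as the `√N` term of
`energyExponent`, and the entropy from Stirling completes `H`. -/
lemma multinomial_mul_exp_eq {q : ℕ} [NeZero q] (p : ℕ) {N : ℕ} (hN : N ≠ 0) (β h β' h' : ℝ) (m : Vec q)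
    (n : Fin q → ℕ) (hn : ∑ r, n r = N) :
    √(N : ℝ) ^ (q - 1) * ((Nat.multinomial Finset.univ n : ℝ) *
      Real.exp ((β + β' / √N) * N * ∑ r, proportions N n r ^ p +
        N * (h + h' / √N) * proportions N n 0 - logNormalization p N β h β' h' m)) =
    stirlingPrefactor N n * Real.exp (energyExponent p N β h β' h' m (proportions N n)) := by
  rw [multinomial_eq_stirlingFactor n N hN hn, stirlingPrefactor, mul_assoc (stirlingFactor N / _),
    ← Real.exp_add, ← mul_assoc]
  congr 2
  have hs : √(N : ℝ) * √N = N := Real.mul_self_sqrt (by positivity)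
  have h0 : √(N : ℝ) ≠ 0 := by positivity
  have h1 : ∀ x : ℝ, x / √N * N = x * √N := fun x => by
    rw [div_mul_eq_mul_div, div_eq_iff h0, mul_assoc, hs]
  have h2 : ∑ r, ((n r : ℝ) / N) * Real.log ((n r : ℝ) / N) =
      ∑ r, proportions N n r * Real.log (proportions N n r) := rfl
  rw [h2, energyExponent, logNormalization]
  have h3 : H p β h (proportions N n) = β * ∑ r, proportions N n r ^ p + h * proportions N n 0 -
    ∑ r, proportions N n r * Real.log (proportions N n r) := rfl
  rw [h3, add_mul, h1, mul_comm (N : ℝ) (h + h' / √N), add_mul h, h1]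
  ring

/-- With deviations of order `1/√N`, the factor `N` extracts the second-order term of `H` and the
factor `√N` the first derivative of the perturbation, which is the pairing with `drift`. -/
lemma tendsto_energyExponent {p q : ℕ} [NeZero q] (hp : 2 ≤ p) {β h : ℝ} (β' h' : ℝ) {m : Vec q}
    (hm : m ∈ maximizers p q β h) {W : ℕ → Vec q} {w : Vec q} (hW : Tendsto W atTop (𝓝 w))
    (hsum : ∀ᶠ N in atTop, ∑ r, W N r = 0) :
    Tendsto (fun N : ℕ => energyExponent p N β h β' h' m (m + (√(N : ℝ))⁻¹ • W N)) atTop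
      (𝓝 (Q p β m w / 2 + ∑ r, drift p β' h' m r * w r)) := by
  have hWr := tendsto_vec_iff.1 hW
  have h1 := tendsto_mul_H_sub hp hm hW hsum
  have h2 := tendsto_finsetSum Finset.univ fun r _ =>
    tendsto_sqrt_mul_sub (hasDerivAt_pow p (m r)) (hWr r)
  have h3 := tendsto_sqrt_mul_sub (hasDerivAt_id (m 0)) (hWr 0)
  have h4 := h1.add ((h2.const_mul β').add (h3.const_mul h'))
  have hlim : Q p β m w / 2 + (β' * ∑ r, ↑p * m r ^ (p - 1) * w r + h' * (1 * w 0)) =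
      Q p β m w / 2 + ∑ r, drift p β' h' m r * w r := by
    congr 1
    simp only [drift, add_mul, Finset.sum_add_distrib, Finset.mul_sum]
    congr 1
    · exact Finset.sum_congr rfl fun r _ => by ring
    · simp
  rw [hlim] at h4
  refine h4.congr fun N => ?_
  simp only [energyExponent, PiLp.add_apply, PiLp.smul_apply, smul_eq_mul, id,
    ← Finset.mul_sum, Finset.sum_sub_distrib]
  ring

/-- All counts grow like `N m_r` with `m_r > 0`, so Stirling applies to each; the powers of `√N`
balance. -/
lemma tendsto_stirlingPrefactor {q : ℕ} [NeZero q] {m : Vec q} (hm : ∀ r, 0 < m r)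
    {n : ℕ → Fin q → ℕ} (hn : Tendsto (fun N => proportions N (n N)) atTop (𝓝 m)) :
    Tendsto (fun N => stirlingPrefactor N (n N)) atTop
      (𝓝 (√(2 * Real.pi) * ∏ r, (√(2 * Real.pi) * √(m r))⁻¹)) := by
  have hnr := tendsto_vec_iff.1 hn
  have hpi : √(2 * Real.pi) ≠ 0 := by positivity
  have hntop : ∀ r, Tendsto (fun N => n N r) atTop atTop := fun r => by
    have h1 : Tendsto (fun N : ℕ => (N : ℝ) * proportions N (n N) r) atTop atTop :=
      tendsto_natCast_atTop_atTop.atTop_mul_pos (hm r) (hnr r)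
    rw [← tendsto_natCast_atTop_iff (R := ℝ)]
    refine h1.congr' ?_
    filter_upwards [eventually_ne_atTop 0] with N hN
    simp only [proportions]
    field_simp
  have h1 : ∀ r, Tendsto (fun N => ((stirlingFactor (n N r) / √(n N r : ℝ)) *
      √(proportions N (n N) r))⁻¹) atTop (𝓝 (√(2 * Real.pi) * √(m r))⁻¹) := fun r =>
    ((tendsto_stirlingFactor_div_sqrt.comp (hntop r)).mul ((hnr r).sqrt)).inv₀
      (mul_ne_zero hpi (Real.sqrt_pos.2 (hm r)).ne')
  have h2 := tendsto_stirlingFactor_div_sqrt.mul (tendsto_finsetProd Finset.univ fun r _ => h1 r)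
  refine h2.congr' ?_
  filter_upwards [eventually_ne_atTop 0, eventually_all.2 fun r => (hntop r).eventually_ne_atTop 0]
    with N hN hnN
  have hN0 : (0 : ℝ) < √(N : ℝ) := by positivity
  have h3 : ∀ r, ((stirlingFactor (n N r) / √(n N r : ℝ)) * √(proportions N (n N) r))⁻¹ =
      √(N : ℝ) * (stirlingFactor (n N r))⁻¹ := fun r => by
    have := hnN r
    have h4 : (0 : ℝ) < √(n N r : ℝ) := by positivity
    have h5 := stirlingFactor_pos (n N r)
    simp only [proportions]
    rw [Real.sqrt_div (by positivity)]
    field_simp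
  simp_rw [h3, Finset.prod_mul_distrib, Finset.prod_const, Finset.card_univ, Fintype.card_fin,
    Finset.prod_inv_distrib, stirlingPrefactor]
  obtain ⟨k, rfl⟩ : ∃ k, q = k + 1 := ⟨q - 1, by have : 1 ≤ q := NeZero.one_le; omega⟩
  rw [Nat.add_sub_cancel, pow_succ]
  field_simp

lemma abs_pow_sub_pow_le_of_unit {x y : ℝ} (hx0 : 0 ≤ x) (hx1 : x ≤ 1) (hy0 : 0 ≤ y) (hy1 : y ≤ 1)
    (p : ℕ) : |x ^ p - y ^ p| ≤ p * |x - y| := by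
  refine (abs_pow_sub_pow_le x y p).trans ?_
  rw [abs_of_nonneg hx0, abs_of_nonneg hy0]
  have : max x y ^ (p - 1) ≤ 1 := pow_le_one₀ (le_max_of_le_left hx0) (max_le hx1 hy1)
  have h2 : 0 ≤ |x - y| * p := by positivity
  nlinarith

lemma probVectors_le_one {q : ℕ} {t : Vec q} (ht : t ∈ probVectors q) (r : Fin q) : t r ≤ 1 := by
  rw [← ht.2]; exact Finset.single_le_sum (fun i _ => ht.1 i) (Finset.mem_univ r)

/-- On the unit interval `x ^ p` is `p`-Lipschitz, so the perturbation costs only a linear term in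
the rescaled deviation, to be beaten by the quadratic decay. -/
lemma energyExponent_le {p q : ℕ} [NeZero q] {β h : ℝ} (β' h' : ℝ) {m t : Vec q}
    (hm : m ∈ probVectors q) (ht : t ∈ probVectors q) {c : ℝ} (N : ℕ)
    (hc : H p β h t - H p β h m ≤ -c * ‖t - m‖ ^ 2) :
    energyExponent p N β h β' h' m t ≤ -c * ‖√(N : ℝ) • (t - m)‖ ^ 2 +
      (|β'| * (q * p) + |h'|) * ‖√(N : ℝ) • (t - m)‖ := by
  have hs : √(N : ℝ) ^ 2 = N := Real.sq_sqrt (by positivity)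
  rw [norm_smul, Real.norm_of_nonneg (Real.sqrt_nonneg _), energyExponent, mul_pow, hs]
  have h1 : (N : ℝ) * (H p β h t - H p β h m) ≤ N * (-c * ‖t - m‖ ^ 2) := by gcongr
  have hr : ∀ r, |t r - m r| ≤ ‖t - m‖ := abs_apply_le_norm (t - m)
  have h2 : |∑ r, t r ^ p - ∑ r, m r ^ p| ≤ (q * p) * ‖t - m‖ := by
    rw [← Finset.sum_sub_distrib]
    calc |∑ r, (t r ^ p - m r ^ p)| ≤ ∑ r, |t r ^ p - m r ^ p| := Finset.abs_sum_le_sum_abs _ _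
      _ ≤ ∑ r : Fin q, p * ‖t - m‖ := Finset.sum_le_sum fun r _ =>
          (abs_pow_sub_pow_le_of_unit (ht.1 r) (probVectors_le_one ht r) (hm.1 r)
            (probVectors_le_one hm r) p).trans (by gcongr; exact hr r)
      _ = (q * p) * ‖t - m‖ := by simp; ring
  have h3 : β' * (∑ r, t r ^ p - ∑ r, m r ^ p) ≤ |β'| * ((q * p) * ‖t - m‖) := by
    refine (le_abs_self _).trans ?_
    rw [abs_mul]; gcongr
  have h4 : h' * (t 0 - m 0) ≤ |h'| * ‖t - m‖ := by
    refine (le_abs_self _).trans ?_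
    rw [abs_mul]; gcongr; exact hr 0
  have h5 : √(N : ℝ) * (β' * (∑ r, t r ^ p - ∑ r, m r ^ p) + h' * (t 0 - m 0)) ≤
      √(N : ℝ) * (|β'| * ((q * p) * ‖t - m‖) + |h'| * ‖t - m‖) := by gcongr
  linarith

/-- The ratio is bounded when the proportion is at least `m_r / 2`. Otherwise it is at most `√N`,
but then the rescaled deviation is at least `√N m_r / 2`, and its exponential absorbs `√N`. -/
lemma sqrt_div_stirlingFactor_le {q : ℕ} {m : Vec q} (hm : ∀ r, 0 < m r) {N : ℕ} (hN : N ≠ 0)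
    (n : Fin q → ℕ) (r : Fin q) :
    √(N : ℝ) / stirlingFactor (n r) ≤
      (√(2 / m r) + 2 / m r) * Real.exp ‖√(N : ℝ) • (proportions N n - m)‖ := by
  set W := √(N : ℝ) • (proportions N n - m) with hW
  have hexp : 1 + ‖W‖ ≤ Real.exp ‖W‖ := by rw [add_comm]; exact Real.add_one_le_exp _
  have hmr := hm r
  have hW0 : 0 ≤ ‖W‖ := norm_nonneg _
  have hs := Real.sqrt_nonneg (2 / m r)
  have hdiv : 0 < 2 / m r := by positivity
  have hN0 : (0 : ℝ) < N := by positivity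
  rcases le_or_gt (m r / 2) (proportions N n r) with hle | hlt
  · have h1 : √(N : ℝ) / stirlingFactor (n r) ≤ √(2 / m r) := by
      rw [div_le_iff₀ (stirlingFactor_pos _)]
      calc √(N : ℝ) ≤ √(2 / m r * n r) := by
            refine Real.sqrt_le_sqrt ?_
            simp only [proportions] at hle
            rw [div_le_div_iff₀ (by norm_num) hN0] at hle
            rw [div_mul_eq_mul_div, le_div_iff₀ hmr]
            linarith
        _ = √(2 / m r) * √(n r) := Real.sqrt_mul hdiv.le _
        _ ≤ √(2 / m r) * stirlingFactor (n r) := by gcongr; exact sqrt_le_stirlingFactor' _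
    nlinarith
  · have h1 : √(N : ℝ) / stirlingFactor (n r) ≤ √(N : ℝ) :=
      div_le_self (Real.sqrt_nonneg _) (one_le_stirlingFactor _)
    have h2 : |W r| ≤ ‖W‖ := abs_apply_le_norm W r
    have h3 : W r = √(N : ℝ) * (proportions N n r - m r) := rfl
    have h4 : √(N : ℝ) * (m r / 2) ≤ ‖W‖ := by
      have h5 : √(N : ℝ) * (m r / 2) ≤ -W r := by
        rw [h3, ← mul_neg]
        gcongr
        linarith
      linarith [neg_abs_le (W r)]
    have h5 : √(N : ℝ) ≤ 2 / m r * ‖W‖ := by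
      rw [div_mul_eq_mul_div, le_div_iff₀ hmr]
      linarith
    nlinarith

lemma exists_stirlingPrefactor_le {q : ℕ} [NeZero q] {m : Vec q} (hm : ∀ r, 0 < m r) :
    ∃ C : ℝ, 0 < C ∧ ∀ (N : ℕ) (n : Fin q → ℕ), N ≠ 0 →
      stirlingPrefactor N n ≤ C * Real.exp (q * ‖√(N : ℝ) • (proportions N n - m)‖) := by
  obtain ⟨C₀, hC₀, hle⟩ := exists_stirlingFactor_le
  refine ⟨C₀ * ∏ r, (√(2 / m r) + 2 / m r), ?_, fun N n hN => ?_⟩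
  · refine mul_pos hC₀ (Finset.prod_pos fun r _ => ?_)
    have := hm r
    positivity
  have hprod : 0 < ∏ r, stirlingFactor (n r) := Finset.prod_pos fun r _ => stirlingFactor_pos _
  calc stirlingPrefactor N n ≤ √(N : ℝ) ^ (q - 1) * (C₀ * √(N : ℝ) / ∏ r, stirlingFactor (n r)) := by
        rw [stirlingPrefactor]; gcongr; exact hle N hN
    _ = C₀ * ∏ r, (√(N : ℝ) / stirlingFactor (n r)) := by
        rw [Finset.prod_div_distrib, Finset.prod_const, Finset.card_univ, Fintype.card_fin]
        obtain ⟨k, hk⟩ : ∃ k, q = k + 1 := ⟨q - 1, by have : 1 ≤ q := NeZero.one_le; omega⟩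
        have hpow : √(N : ℝ) ^ q = √(N : ℝ) ^ (q - 1) * √N := by
          rw [← pow_succ]; congr 1; omega
        rw [hpow]; ring
    _ ≤ C₀ * ∏ r, ((√(2 / m r) + 2 / m r) * Real.exp ‖√(N : ℝ) • (proportions N n - m)‖) := by
        gcongr with r _
        · exact fun r _ => div_nonneg (Real.sqrt_nonneg _) (stirlingFactor_pos _).le
        · exact sqrt_div_stirlingFactor_le hm hN n r
    _ = _ := by
        rw [Finset.prod_mul_distrib, Finset.prod_const, Finset.card_univ, Fintype.card_fin,
          ← Real.exp_nat_mul, mul_assoc]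

lemma mul_sub_sq_le {c x b : ℝ} (hc : 0 < c) : -c * x ^ 2 + b * x ≤ b ^ 2 / (2 * c) - c / 2 * x ^ 2 := by
  have h : b ^ 2 / (2 * c) - c / 2 * x ^ 2 - (-c * x ^ 2 + b * x) = (b - c * x) ^ 2 / (2 * c) := by
    field_simp; ring
  have : 0 ≤ (b - c * x) ^ 2 / (2 * c) := by positivity
  linarith

/-- Rounding moves each free coordinate by at most `1/√N ≤ 1`. Gaussian decay in the lattice
deviation therefore becomes Gaussian decay in `w`, uniformly in `N`. -/
lemma sum_sq_le_norm_latticeDeviation {q : ℕ} (r₀ : Fin q) {N : ℕ} (hN : N ≠ 0) (m : Vec q)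
    (w : {r // r ≠ r₀} → ℝ) :
    ∑ j, w j ^ 2 ≤ 2 * ‖latticeDeviation r₀ N m w‖ ^ 2 + 2 * q := by
  set W := latticeDeviation r₀ N m w with hW
  have h1 : ∀ j : {r // r ≠ r₀}, w j ^ 2 ≤ 2 * W j ^ 2 + 2 := fun j => by
    have h2 := abs_latticeDeviation_sub_le r₀ hN m w j
    have h3 : (√(N : ℝ))⁻¹ ≤ 1 := by
      refine inv_le_one_of_one_le₀ ?_
      rw [Real.one_le_sqrt]
      exact_mod_cast Nat.one_le_iff_ne_zero.2 hN
    have h4 : (W j - w j) ^ 2 ≤ 1 := by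
      rw [sq_le_one_iff_abs_le_one]
      exact h2.trans h3
    nlinarith [sq_nonneg (W j - (w j - W j))]
  have h5 : ∑ j : {r // r ≠ r₀}, W j ^ 2 ≤ ‖W‖ ^ 2 := by
    rw [EuclideanSpace.real_norm_sq_eq, sum_eq_add_sum_subtype r₀ fun r => W r ^ 2]
    linarith [sq_nonneg (W r₀)]
  have h6 : (Fintype.card {r // r ≠ r₀} : ℝ) ≤ q := by
    have : Fintype.card {r // r ≠ r₀} ≤ q := (Fintype.card_subtype_le _).trans (by simp)
    exact_mod_cast this
  calc ∑ j, w j ^ 2 ≤ ∑ j : {r // r ≠ r₀}, (2 * W j ^ 2 + 2) := Finset.sum_le_sum fun j _ => h1 j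
    _ = 2 * ∑ j : {r // r ≠ r₀}, W j ^ 2 + 2 * Fintype.card {r // r ≠ r₀} := by
        rw [Finset.sum_add_distrib, ← Finset.mul_sum]
        simp; ring
    _ ≤ _ := by linarith

lemma integrable_exp_neg_mul_sum_sq {κ : Type*} [Fintype κ] {c : ℝ} (hc : 0 < c) :
    Integrable fun w : κ → ℝ => Real.exp (-c * ∑ j, w j ^ 2) := by
  have h : ∀ w : κ → ℝ, Real.exp (-c * ∑ j, w j ^ 2) = ∏ j, Real.exp (-c * w j ^ 2) := fun w => by
    rw [Finset.mul_sum, Real.exp_sum]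
  simp_rw [h]
  exact Integrable.fintype_prod (f := fun _ x => Real.exp (-c * x ^ 2))
    fun _ => integrable_exp_neg_mul_sq hc

/-! ### Local Laplace asymptotics -/

set_option maxHeartbeats 1000000 in
/-- **Local Laplace asymptotics**: a sum over configurations whose magnetization is close to a
maximizer `m` converges, after normalization, to a Gaussian integral over the zero-sum hyperplane. -/
theorem tendsto_sum_weight {p q : ℕ} [NeZero q] (hp : 2 ≤ p) {β h : ℝ} (β' h' : ℝ) {m : Vec q}
    (hm : m ∈ maximizers p q β h) (hQ : ∀ t : Vec q, ∑ r, t r = 0 → t ≠ 0 → Q p β m t < 0)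
    {ε : ℝ} (hε : 0 < ε) (huniq : ∀ m' ∈ maximizers p q β h, m' ≠ m → ε < dist m m') (r₀ : Fin q)
    {Φ : ℕ → Vec q → ℝ} {Ψ : Vec q → ℝ} {C : ℝ} (hC : ∀ N t, |Φ N t| ≤ C)
    (hsupp : ∀ N t, ε ≤ ‖t - m‖ → Φ N t = 0)
    (hΦ : ∀ (W : ℕ → Vec q) (w : Vec q), Tendsto W atTop (𝓝 w) →
      Tendsto (fun N : ℕ => Φ N (m + (√(N : ℝ))⁻¹ • W N)) atTop (𝓝 (Ψ w))) :
    Tendsto (fun N : ℕ => ∑ x : Fin N → Fin q, weight p N (β + β' / √N) (h + h' / √N) x *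
        Real.exp (-logNormalization p N β h β' h' m) * Φ N (magnetization x)) atTop
      (𝓝 (√(2 * Real.pi) * (∏ r, (√(2 * Real.pi) * √(m r))⁻¹) *
        ∫ w : {r // r ≠ r₀} → ℝ, Real.exp (Q p β m (zeroSumLift r₀ w) / 2 +
          ∑ r, drift p β' h' m r * zeroSumLift r₀ w r) * Ψ (zeroSumLift r₀ w))) := by
  have hmpos := maximizer_pos hp hm
  obtain ⟨c, hc, hcle⟩ := exists_H_sub_le hp hm hQ hε huniq
  obtain ⟨C₁, hC₁, hpre⟩ := exists_stirlingPrefactor_le hmpos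
  have hC0 : 0 ≤ C := (abs_nonneg _).trans (hC 0 0)
  -- The factor `√N ^ (q - 1)` is built into the summand to cancel the Jacobian, so that the
  -- normalized sum is exactly `∫ F N`.
  set G : ℕ → (Fin q → ℕ) → ℝ := fun N n => √(N : ℝ) ^ (q - 1) * ((Nat.multinomial Finset.univ n : ℝ) *
      Real.exp ((β + β' / √N) * N * ∑ r, proportions N n r ^ p +
        N * (h + h' / √N) * proportions N n 0 - logNormalization p N β h β' h' m)) *
      Φ N (proportions N n) with hG
  set F : ℕ → ({r // r ≠ r₀} → ℝ) → ℝ := fun N w =>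
    latticeExtend r₀ N (G N) (fun j => ⌊N * m j + √N * w j⌋) with hF
  have hsumF : ∀ N : ℕ, N ≠ 0 → ∑ x : Fin N → Fin q, weight p N (β + β' / √N) (h + h' / √N) x *
      Real.exp (-logNormalization p N β h β' h' m) * Φ N (magnetization x) = ∫ w, F N w := by
    intro N hN
    have hpow : √(N : ℝ) ^ (q - 1) ≠ 0 := by positivity
    have h1 := sum_piAntidiag_eq_integral r₀ N hN (G N) m
    have h2 : ∑ n ∈ Finset.piAntidiag (Finset.univ : Finset (Fin q)) N, G N n =
        √(N : ℝ) ^ (q - 1) * ∑ x : Fin N → Fin q, weight p N (β + β' / √N) (h + h' / √N) x *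
          Real.exp (-logNormalization p N β h β' h' m) * Φ N (magnetization x) := by
      have h3 := sum_magnetization (N := N) fun t : Vec q =>
        Real.exp ((β + β' / √N) * N * ∑ r, t r ^ p + N * (h + h' / √N) * t 0) *
          Real.exp (-logNormalization p N β h β' h' m) * Φ N t
      simp only [weight]
      rw [h3, Finset.mul_sum]
      refine Finset.sum_congr rfl fun n _ => ?_
      simp only [hG]
      rw [sub_eq_add_neg _ (logNormalization p N β h β' h' m), Real.exp_add _ (-logNormalization _ _ _ _ _ _ _)]
      ring
    rw [h2] at h1
    exact mul_left_cancel₀ hpow h1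
  set z : ℕ → ({r // r ≠ r₀} → ℝ) → Fin q → ℕ := fun N w r =>
    (latticePoint r₀ N (fun j => ⌊N * m j + √N * w j⌋) r).toNat with hz
  have hval : ∀ N w, N ≠ 0 → (∀ r, 0 ≤ latticePoint r₀ N (fun j => ⌊N * m j + √N * w j⌋) r) →
      proportions N (z N w) = latticeProportions r₀ N m w ∧
      F N w = stirlingPrefactor N (z N w) *
        Real.exp (energyExponent p N β h β' h' m (latticeProportions r₀ N m w)) *
        Φ N (latticeProportions r₀ N m w) := by
    intro N w hN hpos
    have hcast : ∀ r, ((z N w r : ℕ) : ℤ) = latticePoint r₀ N (fun j => ⌊N * m j + √N * w j⌋) r :=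
      fun r => Int.toNat_of_nonneg (hpos r)
    have hprop : proportions N (z N w) = latticeProportions r₀ N m w := by
      ext r
      simp only [proportions, latticeProportions, ← hcast r, Int.cast_natCast]
    have hsum : ∑ r, z N w r = N := by
      have := sum_latticePoint r₀ N (fun j => ⌊N * m j + √N * w j⌋)
      simp_rw [← hcast] at this
      exact_mod_cast this
    refine ⟨hprop, ?_⟩
    simp only [hF, latticeExtend, if_pos hpos, hG]
    rw [multinomial_mul_exp_eq p hN β h β' h' m _ hsum]
    change _ * Real.exp (energyExponent p N β h β' h' m (proportions N (z N w))) *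
      Φ N (proportions N (z N w)) = _
    rw [hprop]
  -- The total linear rate in the deviation: the first two terms come from the perturbation, the
  -- last from the bound on the Stirling prefactor.
  set b : ℝ := |β'| * (q * p) + |h'| + q with hb
  have hbound : ∀ N w, N ≠ 0 → ‖F N w‖ ≤ C₁ * Real.exp (b ^ 2 / (2 * c) + c / 2 * q) * C *
      Real.exp (-(c / 4) * ∑ j, w j ^ 2) := by
    intro N w hN
    have hnn : 0 ≤ C₁ * Real.exp (b ^ 2 / (2 * c) + c / 2 * q) * C *
      Real.exp (-(c / 4) * ∑ j, w j ^ 2) := by positivity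
    by_cases hpos : ∀ r, 0 ≤ latticePoint r₀ N (fun j => ⌊N * m j + √N * w j⌋) r
    swap
    · simpa only [hF, latticeExtend, if_neg hpos, norm_zero] using hnn
    obtain ⟨hprop, hFv⟩ := hval N w hN hpos
    rcases le_or_gt ε ‖latticeProportions r₀ N m w - m‖ with hge | hlt
    · rw [hFv, hsupp _ _ hge, mul_zero, norm_zero]
      exact hnn
    set t := latticeProportions r₀ N m w with ht
    have htP : t ∈ probVectors q := ⟨fun r => by
      rw [← hprop]; simp only [proportions]; positivity, sum_latticeProportions r₀ hN m w⟩
    have hW : latticeDeviation r₀ N m w = √(N : ℝ) • (t - m) := rfl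
    set W := latticeDeviation r₀ N m w with hWdef
    have h1 := energyExponent_le (p := p) β' h' hm.1 htP N (hcle t htP hlt.le)
    have h2 := hpre N (z N w) hN
    rw [hprop, ← hW] at h2
    rw [← hW] at h1
    have h3 := sum_sq_le_norm_latticeDeviation r₀ hN m w
    have h4 : -c * ‖W‖ ^ 2 + b * ‖W‖ ≤ _ := mul_sub_sq_le hc
    have hpre0 : 0 ≤ stirlingPrefactor N (z N w) := by
      rw [stirlingPrefactor]
      exact mul_nonneg (by positivity) (div_nonneg (stirlingFactor_pos _).le
        (Finset.prod_nonneg fun r _ => (stirlingFactor_pos _).le))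
    rw [hFv, norm_mul, Real.norm_of_nonneg (by positivity), Real.norm_eq_abs]
    calc stirlingPrefactor N (z N w) * Real.exp (energyExponent p N β h β' h' m t) * |Φ N t|
        ≤ C₁ * Real.exp (q * ‖W‖) * Real.exp (-c * ‖W‖ ^ 2 + (|β'| * (q * p) + |h'|) * ‖W‖) * C := by
          gcongr
          exact hC N t
      _ = C₁ * Real.exp (-c * ‖W‖ ^ 2 + b * ‖W‖) * C := by
          rw [mul_assoc C₁, ← Real.exp_add]
          congr 3
          rw [hb]; ring
      _ ≤ C₁ * Real.exp (b ^ 2 / (2 * c) + c / 2 * q + -(c / 4) * ∑ j, w j ^ 2) * C := by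
          refine mul_le_mul_of_nonneg_right
            (mul_le_mul_of_nonneg_left (Real.exp_le_exp.2 ?_) hC₁.le) hC0
          have h5 : c / 4 * ∑ j, w j ^ 2 ≤ c / 4 * (2 * ‖W‖ ^ 2 + 2 * q) := by gcongr
          linarith
      _ = _ := by rw [Real.exp_add _ (-(c / 4) * _)]; ring
  have hlim : ∀ w, Tendsto (fun N => F N w) atTop
      (𝓝 (√(2 * Real.pi) * (∏ r, (√(2 * Real.pi) * √(m r))⁻¹) *
        (Real.exp (Q p β m (zeroSumLift r₀ w) / 2 +
          ∑ r, drift p β' h' m r * zeroSumLift r₀ w r) * Ψ (zeroSumLift r₀ w)))) := by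
    intro w
    have hdev := tendsto_latticeDeviation r₀ hm.1.2 w
    have hN0 : ∀ᶠ N : ℕ in atTop, N ≠ 0 := eventually_ne_atTop 0
    have hprop : Tendsto (fun N => latticeProportions r₀ N m w) atTop (𝓝 m) := by
      have h1 := (tendsto_inv_sqrt_natCast.smul hdev).const_add m
      rw [zero_smul, add_zero] at h1
      refine h1.congr' ?_
      filter_upwards [hN0] with N hN
      exact add_smul_latticeDeviation r₀ hN m w
    -- All coordinates of `m` are positive, so for fixed `w` the lattice point eventually lies in
    -- the simplex and the extension by zero plays no role.
    have hpos : ∀ᶠ N : ℕ in atTop,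
        ∀ r, 0 ≤ latticePoint r₀ N (fun j => ⌊N * m j + √N * w j⌋) r := by
      refine eventually_all.2 fun r => ?_
      filter_upwards [(tendsto_vec_iff.1 hprop r).eventually (eventually_gt_nhds (hmpos r)), hN0]
        with N h1 hN
      have hNp : (0 : ℝ) < N := by positivity
      simp only [latticeProportions] at h1
      have h2 := (div_pos_iff_of_pos_right hNp).1 h1
      exact_mod_cast h2.le
    have hz' : Tendsto (fun N => proportions N (z N w)) atTop (𝓝 m) := by
      refine hprop.congr' ?_
      filter_upwards [hN0, hpos] with N hN h1
      exact (hval N w hN h1).1.symm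
    have h1 := tendsto_stirlingPrefactor hmpos hz'
    have h2 := (Real.continuous_exp.tendsto _).comp (tendsto_energyExponent hp β' h' hm hdev
      (hN0.mono fun N hN => sum_latticeDeviation r₀ hN hm.1.2 w))
    have h3 := (h1.mul h2).mul (hΦ _ _ hdev)
    rw [mul_assoc] at h3
    refine h3.congr' ?_
    filter_upwards [hN0, hpos] with N hN hp'
    rw [(hval N w hN hp').2, Function.comp_apply, add_smul_latticeDeviation r₀ hN]
  have hmeasF : ∀ N, AEStronglyMeasurable (F N) volume := fun N => by
    have h1 : Measurable (fun (w : {r // r ≠ r₀} → ℝ) (j : {r // r ≠ r₀}) => ⌊(N : ℝ) * m j + √N * w j⌋) :=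
      measurable_pi_lambda _ fun j => Int.measurable_floor.comp (by fun_prop)
    exact ((Measurable.of_discrete (f := latticeExtend r₀ N (G N))).comp h1).aestronglyMeasurable
  have hDCT := tendsto_integral_filter_of_dominated_convergence
    (fun w : {r // r ≠ r₀} → ℝ => C₁ * Real.exp (b ^ 2 / (2 * c) + c / 2 * q) * C *
      Real.exp (-(c / 4) * ∑ j, w j ^ 2)) (Eventually.of_forall hmeasF)
    ((eventually_ne_atTop 0).mono fun N hN => Eventually.of_forall fun w => hbound N w hN)
    ((integrable_exp_neg_mul_sum_sq (by positivity)).const_mul _)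
    (Eventually.of_forall hlim)
  rw [integral_const_mul] at hDCT
  refine hDCT.congr' ?_
  filter_upwards [eventually_ne_atTop 0] with N hN
  exact (hsumF N hN).symm

/-! ### Identification of the constants `tau` and `Sig` -/

/-- The diagonal coefficients of the form `-Q`. -/
def negHessian {q : ℕ} (p : ℕ) (β : ℝ) (m : Vec q) (r : Fin q) : ℝ := -kDeriv₂ p β (m r)

lemma posDef_hyperplaneForm_negHessian {p q : ℕ} {β : ℝ} {m : Vec q}
    (hQ : ∀ t : Vec q, ∑ r, t r = 0 → t ≠ 0 → Q p β m t < 0) (r₀ : Fin q) :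
    (hyperplaneForm r₀ (negHessian p β m)).PosDef := by
  refine posDef_hyperplaneForm r₀ _ fun t ht h0 => ?_
  have := hQ t ht h0
  rw [Q_eq] at this
  simp only [negHessian, neg_mul, Finset.sum_neg_distrib]
  linarith

open Matrix in
lemma Q_zeroSumLift {p q : ℕ} {β : ℝ} {m : Vec q} (r₀ : Fin q) (w : {r // r ≠ r₀} → ℝ) :
    Q p β m (zeroSumLift r₀ w) / 2 =
      -(1 / 2) * (w ⬝ᵥ hyperplaneForm r₀ (negHessian p β m) *ᵥ w) := by
  rw [dotProduct_hyperplaneForm, Q_eq]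
  simp only [negHessian, neg_mul, Finset.sum_neg_distrib, zeroSumLift]
  ring

lemma exists_ne_of_two_le {q : ℕ} (hq : 2 ≤ q) (r₀ : Fin q) : ∃ j, j ≠ r₀ := by
  have : Nontrivial (Fin q) := Fin.nontrivial_iff_two_le.2 hq
  exact exists_ne r₀

section PermutedMaximizer

variable {p q : ℕ} [NeZero q] {β h s : ℝ} {m : Vec q} {σ : Equiv.Perm (Fin q)}

lemma permuted_apply_symm_zero (hσ : m = mulVec (σ.permMatrix ℝ) (xvec q s)) :
    m (σ.symm 0) = (1 + (q - 1) * s) / q := by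
  rw [hσ, permMatrix_mulVec_apply]
  simp [xvec]

lemma permuted_apply_of_ne (hσ : m = mulVec (σ.permMatrix ℝ) (xvec q s)) {r : Fin q}
    (hr : r ≠ σ.symm 0) : m r = (1 - s) / q := by
  have : σ r ≠ 0 := fun h0 => hr (by rw [← h0]; simp)
  rw [hσ, permMatrix_mulVec_apply]
  simp [xvec, this]

lemma permuted_pos (hp : 2 ≤ p) (hq : 2 ≤ q) (hm : m ∈ maximizers p q β h)
    (hσ : m = mulVec (σ.permMatrix ℝ) (xvec q s)) :
    0 < (1 + ((q : ℝ) - 1) * s) / q ∧ 0 < (1 - s) / q := by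
  obtain ⟨j, hj⟩ := exists_ne_of_two_le hq (σ.symm 0)
  rw [← permuted_apply_symm_zero hσ, ← permuted_apply_of_ne hσ hj]
  exact ⟨maximizer_pos hp hm _, maximizer_pos hp hm _⟩

/-- The right-hand side is the nontrivial factor of the determinant of `-Q` on the hyperplane; this
is how `f''` enters `tau` and `Sig`. -/
lemma neg_f''_eq (hp : 2 ≤ p) (hq : 2 ≤ q) (hm : m ∈ maximizers p q β h)
    (hσ : m = mulVec (σ.permMatrix ℝ) (xvec q s)) :
    -((q : ℝ) ^ 2 / (q - 1)) * f'' p q β h s = -k'' p β ((1 - s) / q) +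
      (q - 1) * negHessian p β m (σ.symm 0) := by
  obtain ⟨ha, hb⟩ := permuted_pos hp hq hm hσ
  have hq1 : (q : ℝ) - 1 ≠ 0 := by
    have : (2 : ℝ) ≤ q := by exact_mod_cast hq
    linarith
  have hq0 : (q : ℝ) ≠ 0 := by positivity
  rw [f''_eq hp β h ha hb, negHessian, permuted_apply_symm_zero hσ, k''_eq hp β hb]
  field_simp
  ring

/-- For `q ≥ 3` there are two equal coordinates outside the distinguished one, and the difference of
their basis vectors gives `2 k'' < 0`. -/
lemma neg_k''_ne_zero (hp : 2 ≤ p) (hq : 3 ≤ q) (hm : m ∈ maximizers p q β h)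
    (hQ : ∀ t : Vec q, ∑ r, t r = 0 → t ≠ 0 → Q p β m t < 0)
    (hσ : m = mulVec (σ.permMatrix ℝ) (xvec q s)) : -k'' p β ((1 - s) / q) ≠ 0 := by
  obtain ⟨ha, hb⟩ := permuted_pos hp (by omega) hm hσ
  obtain ⟨j, hj⟩ := exists_ne_of_two_le (by omega) (σ.symm 0)
  obtain ⟨j', hj', hj'j⟩ : ∃ j', j' ≠ σ.symm 0 ∧ j' ≠ j := by
    have hcard : ({σ.symm 0, j} : Finset (Fin q)).card < Fintype.card (Fin q) := by
      rw [Fintype.card_fin]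
      exact (Finset.card_le_two).trans_lt hq
    obtain ⟨j', hj'⟩ := Finset.exists_mem_notMem_of_card_lt_card (s := {σ.symm 0, j})
      (t := Finset.univ) (by simpa using hcard)
    exact ⟨j', by simpa using hj'.2⟩
  have := maximizer_kDeriv₂_add_neg hQ hj'j
  rw [permuted_apply_of_ne hσ hj, permuted_apply_of_ne hσ hj', ← k''_eq hp β hb] at this
  linarith

lemma negHessian_of_ne (hp : 2 ≤ p) (hq : 2 ≤ q) (hm : m ∈ maximizers p q β h)
    (hσ : m = mulVec (σ.permMatrix ℝ) (xvec q s)) {r : Fin q} (hr : r ≠ σ.symm 0) :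
    negHessian p β m r = -k'' p β ((1 - s) / q) := by
  obtain ⟨ha, hb⟩ := permuted_pos hp hq hm hσ
  rw [negHessian, permuted_apply_of_ne hσ hr, k''_eq hp β hb]

lemma det_hyperplaneForm_negHessian (hp : 2 ≤ p) (hq : 2 ≤ q) (hm : m ∈ maximizers p q β h)
    (hQ : ∀ t : Vec q, ∑ r, t r = 0 → t ≠ 0 → Q p β m t < 0)
    (hσ : m = mulVec (σ.permMatrix ℝ) (xvec q s)) :
    (hyperplaneForm (σ.symm 0) (negHessian p β m)).det =
      (-k'' p β ((1 - s) / q)) ^ (q - 2) * (-((q : ℝ) ^ 2 / (q - 1)) * f'' p q β h s) := by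
  rw [det_hyperplaneForm hq (σ.symm 0) _ (-k'' p β ((1 - s) / q))
    (fun r hr => negHessian_of_ne hp hq hm hσ hr) (fun h3 => neg_k''_ne_zero hp h3 hm hQ hσ),
    neg_f''_eq hp hq hm hσ]

open Matrix in
lemma permMatrix_mul_Sig_mul_transpose (hp : 2 ≤ p) (hq : 2 ≤ q) (hm : m ∈ maximizers p q β h)
    (hQ : ∀ t : Vec q, ∑ r, t r = 0 → t ≠ 0 → Q p β m t < 0)
    (hσ : m = mulVec (σ.permMatrix ℝ) (xvec q s)) :
    σ.permMatrix ℝ * Sig p q β h s * (σ.permMatrix ℝ)ᵀ =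
      liftMatrix (σ.symm 0) * (hyperplaneForm (σ.symm 0) (negHessian p β m))⁻¹ *
        (liftMatrix (σ.symm 0))ᵀ := by
  have hdet := (posDef_hyperplaneForm_negHessian hQ (σ.symm 0)).det_pos
  rw [det_hyperplaneForm_negHessian hp hq hm hQ hσ] at hdet
  have h0 : -((q : ℝ) ^ 2 / (q - 1)) * f'' p q β h s ≠ 0 := (right_ne_zero_of_mul hdet.ne')
  have heq := neg_f''_eq hp hq hm hσ
  obtain ⟨ha, hb⟩ := permuted_pos hp hq hm hσ
  rw [liftMatrix_mul_inv_mul_transpose hq (σ.symm 0) _ (-k'' p β ((1 - s) / q))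
    (fun r hr => negHessian_of_ne hp hq hm hσ hr) (fun h3 => neg_k''_ne_zero hp h3 hm hQ hσ)
    (by rwa [← heq]), ← heq]
  have hρ : negHessian p β m (σ.symm 0) / -k'' p β ((1 - s) / q) =
      k'' p β ((1 + (q - 1) * s) / q) / k'' p β ((1 - s) / q) := by
    rw [negHessian, permuted_apply_symm_zero hσ, ← k''_eq hp β ha, neg_div_neg_eq]
  rw [hρ]
  have hP : ∀ S : Matrix (Fin q) (Fin q) ℝ, σ.permMatrix ℝ * S * (σ.permMatrix ℝ)ᵀ =
      S.submatrix σ σ := by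
    intro S
    ext r r'
    simp [Matrix.mul_apply, Equiv.Perm.permMatrix, PEquiv.toMatrix_apply, Equiv.toPEquiv_apply,
      Equiv.symm_apply_eq]
  rw [hP]
  ext r r'
  have e : ∀ r, σ r = 0 ↔ r = σ.symm 0 := fun r => by rw [Equiv.eq_symm_apply]
  simp only [Sig, covMatrix, submatrix_apply, Matrix.smul_apply, of_apply, e, σ.injective.eq_iff]

open Matrix in
lemma posSemidef_permMatrix_mul_Sig (hp : 2 ≤ p) (hq : 2 ≤ q) (hm : m ∈ maximizers p q β h)
    (hQ : ∀ t : Vec q, ∑ r, t r = 0 → t ≠ 0 → Q p β m t < 0)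
    (hσ : m = mulVec (σ.permMatrix ℝ) (xvec q s)) :
    (σ.permMatrix ℝ * Sig p q β h s * (σ.permMatrix ℝ)ᵀ).PosSemidef := by
  rw [permMatrix_mul_Sig_mul_transpose hp hq hm hQ hσ]
  have := (posDef_hyperplaneForm_negHessian hQ (σ.symm 0)).inv.posSemidef.mul_mul_conjTranspose_same
    (liftMatrix (σ.symm 0))
  simpa using this

/-- All powers of `2π` cancel. The factor `√((q - 1) / q²)`, which converts `f''` into the
determinant, is the same for every maximizer and drops out of the mixture weights. -/
lemma gaussian_normalization_eq_tau (hp : 2 ≤ p) (hq : 2 ≤ q) (hm : m ∈ maximizers p q β h)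
    (hQ : ∀ t : Vec q, ∑ r, t r = 0 → t ≠ 0 → Q p β m t < 0)
    (hσ : m = mulVec (σ.permMatrix ℝ) (xvec q s)) :
    √(2 * Real.pi) * (∏ r, (√(2 * Real.pi) * √(m r))⁻¹) *
      ((2 * Real.pi) ^ ((Fintype.card {r // r ≠ σ.symm 0} : ℝ) / 2) /
        √(hyperplaneForm (σ.symm 0) (negHessian p β m)).det) =
      √(((q : ℝ) - 1) / q ^ 2) * tau p q β h s m ∧ 0 < tau p q β h s m := by
  have hdet := (posDef_hyperplaneForm_negHessian hQ (σ.symm 0)).det_pos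
  have hdeteq := det_hyperplaneForm_negHessian hp hq hm hQ hσ
  set d := (hyperplaneForm (σ.symm 0) (negHessian p β m)).det with hd
  have hprod : 0 < ∏ r, m r := Finset.prod_pos fun r _ => maximizer_pos hp hm r
  have hq1 : (0 : ℝ) < (q : ℝ) - 1 := by
    have : (2 : ℝ) ≤ q := by exact_mod_cast hq
    linarith
  have hq0 : (0 : ℝ) < q := by positivity
  set B := -k'' p β ((1 - s) / q) with hB
  have hBpow : B ^ (q - 2) ≠ 0 := by
    intro h0; rw [hdeteq, h0, zero_mul] at hdet; exact hdet.false
  have hf0 : f'' p q β h s ≠ 0 := by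
    intro h0; rw [hdeteq, h0, mul_zero, mul_zero] at hdet; exact hdet.false
  have hz : B ^ (2 - (q : ℤ)) = (B ^ (q - 2))⁻¹ := by
    have : (2 - (q : ℤ)) = -((q - 2 : ℕ) : ℤ) := by omega
    rw [this, zpow_neg, zpow_natCast]
  have hinner : (((q : ℝ) - 1) / q ^ 2) * ((-f'' p q β h s)⁻¹ * B ^ (2 - (q : ℤ)) / ∏ r, m r) =
      (d * ∏ r, m r)⁻¹ := by
    rw [hz, hdeteq]
    field_simp
  have hc : 0 < ((q : ℝ) - 1) / q ^ 2 := by positivity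
  have hpos : 0 < (-f'' p q β h s)⁻¹ * B ^ (2 - (q : ℤ)) / ∏ r, m r := by
    refine pos_of_mul_pos_right (a := ((q : ℝ) - 1) / q ^ 2) ?_ hc.le
    rw [hinner]; positivity
  refine ⟨?_, Real.sqrt_pos.2 hpos⟩
  rw [tau, ← Real.sqrt_mul hc.le, hinner, Real.sqrt_inv, Real.sqrt_mul hdet.le]
  have hcard : Fintype.card {r // r ≠ σ.symm 0} = q - 1 := by simp [Fintype.card_subtype_compl]
  have hpi : (0 : ℝ) < 2 * Real.pi := by positivity
  have hpow : (2 * Real.pi) ^ ((Fintype.card {r // r ≠ σ.symm 0} : ℝ) / 2) =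
      √(2 * Real.pi) ^ (q - 1) := by
    rw [hcard, Real.sqrt_eq_rpow, ← Real.rpow_natCast, ← Real.rpow_mul hpi.le]
    congr 1; ring
  have hsq : √(∏ r, m r) = ∏ r, √(m r) :=
    Real.sqrt_prod _ fun r _ => (maximizer_pos hp hm r).le
  rw [hpow, hsq, Finset.prod_inv_distrib, Finset.prod_mul_distrib, Finset.prod_const,
    Finset.card_univ, Fintype.card_fin]
  have hpq : √(2 * Real.pi) ^ q = √(2 * Real.pi) ^ (q - 1) * √(2 * Real.pi) := by
    rw [← pow_succ]; congr 1; omega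
  rw [hpq]
  have h1 : 0 < √(2 * Real.pi) := Real.sqrt_pos.2 hpi
  have h2 : 0 < √d := Real.sqrt_pos.2 hdet
  have h3 : 0 < ∏ r, √(m r) := Finset.prod_pos fun r _ => Real.sqrt_pos.2 (maximizer_pos hp hm r)
  field_simp

open Matrix in
lemma integral_exp_Q_mul_eq (hp : 2 ≤ p) (hq : 2 ≤ q) (hm : m ∈ maximizers p q β h)
    (hQ : ∀ t : Vec q, ∑ r, t r = 0 → t ≠ 0 → Q p β m t < 0)
    (hσ : m = mulVec (σ.permMatrix ℝ) (xvec q s)) (d : Vec q)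
    (g : BoundedContinuousFunction (Vec q) ℝ) :
    √(2 * Real.pi) * (∏ r, (√(2 * Real.pi) * √(m r))⁻¹) *
      ∫ w : {r // r ≠ σ.symm 0} → ℝ, Real.exp (Q p β m (zeroSumLift (σ.symm 0) w) / 2 +
          ∑ r, d r * zeroSumLift (σ.symm 0) w r) * g (zeroSumLift (σ.symm 0) w) =
      √(((q : ℝ) - 1) / q ^ 2) * tau p q β h s m *
        Real.exp (d.ofLp ⬝ᵥ (σ.permMatrix ℝ * Sig p q β h s * (σ.permMatrix ℝ)ᵀ) *ᵥ d.ofLp / 2) *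
        ∫ x, g x ∂(multivariateGaussian
          (mulVec (σ.permMatrix ℝ * Sig p q β h s * (σ.permMatrix ℝ)ᵀ) d)
          (σ.permMatrix ℝ * Sig p q β h s * (σ.permMatrix ℝ)ᵀ)) := by
  have h1 := integral_gaussian_density_eq _ (posDef_hyperplaneForm_negHessian hQ (σ.symm 0))
    (liftMatrix (σ.symm 0)) d.ofLp g
  rw [← permMatrix_mul_Sig_mul_transpose hp hq hm hQ hσ] at h1
  have h2 := (gaussian_normalization_eq_tau hp hq hm hQ hσ).1
  have h3 : ∀ w : {r // r ≠ σ.symm 0} → ℝ, Real.exp (Q p β m (zeroSumLift (σ.symm 0) w) / 2 +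
          ∑ r, d r * zeroSumLift (σ.symm 0) w r) * g (zeroSumLift (σ.symm 0) w) =
      g (WithLp.toLp 2 (liftMatrix (σ.symm 0) *ᵥ w)) *
        Real.exp (-(1 / 2) * (w ⬝ᵥ hyperplaneForm (σ.symm 0) (negHessian p β m) *ᵥ w) +
          d.ofLp ⬝ᵥ (liftMatrix (σ.symm 0) *ᵥ w)) := fun w => by
    rw [Q_zeroSumLift, mul_comm]
    rfl
  simp_rw [h3]
  rw [h1, ← h2]
  simp only [mulVec]
  ring

end PermutedMaximizer

/-! ### Expectations under the model and negligible configurations -/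

lemma integral_potts {p q : ℕ} [NeZero q] (N : ℕ) (β h : ℝ) (g : (Fin N → Fin q) → ℝ) :
    ∫ x, g x ∂(potts p q N β h) = (∑ x, weight p N β h x * g x) / ∑ x : Fin N → Fin q, weight p N β h x := by
  have hpos : 0 ≤ ∑ x : Fin N → Fin q, weight p N β h x :=
    Finset.sum_nonneg fun x _ => (Real.exp_pos _).le
  rw [potts, integral_finsetSum_measure fun x _ => Integrable.of_finite.smul_measure (by simp),
    Finset.sum_div]
  refine Finset.sum_congr rfl fun x _ => ?_
  rw [integral_smul_measure, integral_dirac,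
    ENNReal.toReal_ofReal (div_nonneg (show 0 ≤ weight p N β h x from (Real.exp_pos _).le) hpos), smul_eq_mul]
  ring

-- The formula also covers an event of weight zero: the conditional measure is then 0 and the
-- quotient is 0 by convention.
open Classical in
lemma integral_cond_potts {p q : ℕ} [NeZero q] (N : ℕ) (β h : ℝ) (s : Set (Fin N → Fin q))
    (g : (Fin N → Fin q) → ℝ) :
    ∫ x, g x ∂(ProbabilityTheory.cond (potts p q N β h) s) =
      (∑ x, weight p N β h x * (if x ∈ s then g x else 0)) /
        ∑ x, weight p N β h x * (if x ∈ s then 1 else 0) := by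
  have hZ : ∑ x : Fin N → Fin q, weight p N β h x ≠ 0 :=
    (Finset.sum_pos (fun x _ => Real.exp_pos _) ⟨fun _ => 0, Finset.mem_univ _⟩).ne'
  have hs : MeasurableSet s := s.toFinite.measurableSet
  have hind : ∀ g : (Fin N → Fin q) → ℝ, s.indicator g = fun x => if x ∈ s then g x else 0 :=
    fun g => by funext x; simp [Set.indicator_apply]
  have h1 : (potts p q N β h).real s =
      (∑ x, weight p N β h x * (if x ∈ s then 1 else 0)) / ∑ x : Fin N → Fin q, weight p N β h x := by
    rw [← integral_potts, ← integral_indicator_one hs]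
    congr 1
  rw [ProbabilityTheory.cond, integral_smul_measure, ← integral_indicator hs, hind, integral_potts,
    ENNReal.toReal_inv, ← measureReal_def, h1, smul_eq_mul, inv_div]
  field_simp

lemma tendsto_pow_mul_exp_neg_natCast (k : ℕ) {η : ℝ} (hη : 0 < η) :
    Tendsto (fun N : ℕ => ((N : ℝ) + 1) ^ k * Real.exp (-(N * η))) atTop (𝓝 0) := by
  have h1 : Tendsto (fun N : ℕ => η * ((N : ℝ) + 1)) atTop atTop :=
    (tendsto_natCast_atTop_atTop.atTop_add tendsto_const_nhds).const_mul_atTop hη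
  have h2 := ((Real.tendsto_pow_mul_exp_neg_atTop_nhds_zero k).comp h1).mul_const
    (Real.exp η / η ^ k)
  rw [zero_mul] at h2
  refine h2.congr fun N => ?_
  simp only [Function.comp_apply]
  have h3 : Real.exp (-(N * η)) = Real.exp (-(η * (N + 1))) * Real.exp η := by
    rw [← Real.exp_add]; congr 1; ring
  rw [h3, mul_pow]
  field_simp

/-- Configurations whose magnetization stays away from the maximizers are negligible. -/
lemma tendsto_sum_weight_of_away {p q : ℕ} [NeZero q] {β h : ℝ} {m : Vec q}
    (hm : m ∈ maximizers p q β h) {R : Vec q → ℝ} {C : ℝ} (hC : ∀ t, |R t| ≤ C) {ε : ℝ} (hε : 0 < ε)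
    (hR : ∀ t, ∀ m' ∈ maximizers p q β h, dist t m' < ε → R t = 0) :
    Tendsto (fun N : ℕ => ∑ x : Fin N → Fin q, weight p N β h x *
      Real.exp (-(N * H p β h m)) * R (magnetization x)) atTop (𝓝 0) := by
  have hC0 : 0 ≤ C := (abs_nonneg _).trans (hC 0)
  set S : Set (Vec q) := probVectors q ∩ {t | ∀ m' ∈ maximizers p q β h, ε ≤ dist t m'} with hS
  have hSclosed : IsClosed {t : Vec q | ∀ m' ∈ maximizers p q β h, ε ≤ dist t m'} := by
    have : {t : Vec q | ∀ m' ∈ maximizers p q β h, ε ≤ dist t m'} =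
        ⋂ m' ∈ maximizers p q β h, {t | ε ≤ dist t m'} := by ext t; simp
    rw [this]
    exact isClosed_biInter fun m' _ => isClosed_le continuous_const (by fun_prop)
  -- The part of the simplex at distance at least `ε` from all maximizers is compact and contains
  -- none of them.
  have hη : ∃ η : ℝ, 0 < η ∧ ∀ t ∈ S, H p β h t - H p β h m ≤ -η := by
    rcases S.eq_empty_or_nonempty with h0 | hne
    · exact ⟨1, one_pos, fun t ht => by rw [h0] at ht; exact ht.elim⟩
    · obtain ⟨t₀, ht₀, hmax⟩ := ((isCompact_probVectors q).inter_right hSclosed).exists_isMaxOn hne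
        (continuous_H p β h).continuousOn
      refine ⟨H p β h m - H p β h t₀, ?_, fun t ht => ?_⟩
      · have hne : H p β h t₀ ≠ H p β h m := fun heq => by
          have hmem : t₀ ∈ maximizers p q β h := ⟨ht₀.1, fun t ht => by
            simp only [Set.mem_ofPred_eq, heq]; exact hm.2 ht⟩
          have := ht₀.2 t₀ hmem
          rw [dist_self] at this
          linarith
        have := lt_of_le_of_ne (hm.2 ht₀.1) hne
        linarith
      · have : H p β h t ≤ H p β h t₀ := hmax ht
        linarith
  obtain ⟨η, hηpos, hηle⟩ := hη
  obtain ⟨C₀, hC₀, hle⟩ := exists_stirlingFactor_le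
  have hlim := (tendsto_pow_mul_exp_neg_natCast (q + 1) hηpos).const_mul (C₀ * C)
  rw [mul_zero] at hlim
  refine squeeze_zero_norm' ?_ hlim
  filter_upwards [eventually_ne_atTop 0] with N hN
  have h1 := sum_magnetization (N := N) fun t : Vec q => Real.exp (β * N * ∑ r, t r ^ p + N * h * t 0) *
    Real.exp (-(N * H p β h m)) * R t
  simp only [weight]
  rw [h1]
  have hN1 : (1 : ℝ) ≤ N + 1 := by linarith [(Nat.cast_nonneg N : (0 : ℝ) ≤ N)]
  -- There are only polynomially many count vectors, so a uniform exponential bound on the terms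
  -- suffices.
  have hcard : ((Finset.piAntidiag (Finset.univ : Finset (Fin q)) N).card : ℝ) ≤ ((N : ℝ) + 1) ^ q := by
    have hsub : Finset.piAntidiag (Finset.univ : Finset (Fin q)) N ⊆
        Fintype.piFinset fun _ => Finset.range (N + 1) := fun n hn => by
      rw [Fintype.mem_piFinset]
      intro r
      rw [Finset.mem_range, Nat.lt_succ_iff, ← (Finset.mem_piAntidiag.1 hn).1]
      exact Finset.single_le_sum (fun i _ => Nat.zero_le (n i)) (Finset.mem_univ r)
    have := Finset.card_le_card hsub
    simp only [Fintype.card_piFinset_const, Finset.card_range] at this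
    exact_mod_cast this
  have hterm : ∀ n ∈ Finset.piAntidiag (Finset.univ : Finset (Fin q)) N,
      ‖(Nat.multinomial Finset.univ n : ℝ) * (Real.exp (β * N * ∑ r, proportions N n r ^ p +
        N * h * proportions N n 0) * Real.exp (-(N * H p β h m)) * R (proportions N n))‖ ≤
      C₀ * (N + 1) * Real.exp (-(N * η)) * C := by
    intro n hn
    have hsum := (Finset.mem_piAntidiag.1 hn).1
    have hnn : 0 ≤ C₀ * ((N : ℝ) + 1) * Real.exp (-(N * η)) * C := by positivity
    set t := proportions N n with ht
    have htP : t ∈ probVectors q := by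
      refine ⟨fun r => by rw [ht]; simp only [proportions]; positivity, ?_⟩
      rw [ht]
      simp only [proportions]
      rw [← Finset.sum_div, ← Nat.cast_sum, hsum]
      exact div_self (by positivity)
    by_cases hR0 : R t = 0
    · rw [hR0, mul_zero, mul_zero, norm_zero]; exact hnn
    have htS : t ∈ S := ⟨htP, fun m' hm' => not_lt.1 fun hlt => hR0 (hR t m' hm' hlt)⟩
    have hH := hηle t htS
    have hH' : H p β h t = β * ∑ r, t r ^ p + h * t 0 - ∑ r, t r * Real.log (t r) := rfl
    have hlog : ∑ r, ((n r : ℝ) / N) * Real.log ((n r : ℝ) / N) = ∑ r, t r * Real.log (t r) := rfl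
    have hprod : 1 ≤ ∏ r, stirlingFactor (n r) :=
      (Finset.prod_const_one (s := (Finset.univ : Finset (Fin q)))).symm.le.trans
        (Finset.prod_le_prod (fun _ _ => zero_le_one) fun r _ => one_le_stirlingFactor _)
    have hS1 : stirlingFactor N / ∏ r, stirlingFactor (n r) ≤ C₀ * (N + 1) := by
      refine (div_le_self (stirlingFactor_pos N).le hprod).trans ((hle N hN).trans ?_)
      gcongr
      rw [Real.sqrt_le_left (by positivity)]
      nlinarith [(Nat.cast_nonneg N : (0 : ℝ) ≤ N)]
    have hS0 : 0 ≤ stirlingFactor N / ∏ r, stirlingFactor (n r) :=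
      div_nonneg (stirlingFactor_pos N).le (by linarith)
    rw [multinomial_eq_stirlingFactor n N hN hsum, hlog, ← mul_assoc, norm_mul, ← Real.exp_add,
      mul_assoc, ← Real.exp_add, norm_mul, Real.norm_of_nonneg hS0, Real.norm_of_nonneg (Real.exp_pos _).le,
      Real.norm_eq_abs]
    have hexp : -(N * ∑ r, t r * Real.log (t r)) + (β * N * ∑ r, t r ^ p + N * h * t 0 +
        -(N * H p β h m)) ≤ -(N * η) := by
      have : (N : ℝ) * (H p β h t - H p β h m) ≤ N * -η := by gcongr
      rw [hH'] at this
      linarith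
    gcongr
    exact hC t
  calc ‖∑ n ∈ Finset.piAntidiag (Finset.univ : Finset (Fin q)) N,
        (Nat.multinomial Finset.univ n : ℝ) * (Real.exp (β * N * ∑ r, proportions N n r ^ p +
        N * h * proportions N n 0) * Real.exp (-(N * H p β h m)) * R (proportions N n))‖
      ≤ ∑ n ∈ Finset.piAntidiag (Finset.univ : Finset (Fin q)) N,
          C₀ * (N + 1) * Real.exp (-(N * η)) * C := norm_sum_le_of_le _ hterm
    _ = (Finset.piAntidiag (Finset.univ : Finset (Fin q)) N).card *
          (C₀ * (N + 1) * Real.exp (-(N * η)) * C) := by simp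
    _ ≤ ((N : ℝ) + 1) ^ q * (C₀ * (N + 1) * Real.exp (-(N * η)) * C) := by gcongr
    _ = C₀ * C * (((N : ℝ) + 1) ^ (q + 1) * Real.exp (-(N * η))) := by ring

/-! ### The limit theorems -/

section PermutedMaximizer

variable {p q : ℕ} [NeZero q] {β h s : ℝ} {m : Vec q} {σ : Equiv.Perm (Fin q)}

open Classical in
/-- The contribution of a neighbourhood of a maximizer to the expectation of a function of the
magnetization. -/
lemma tendsto_sum_weight_ball (hp : 2 ≤ p) (hq : 2 ≤ q) (hm : m ∈ maximizers p q β h)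
    (hQ : ∀ t : Vec q, ∑ r, t r = 0 → t ≠ 0 → Q p β m t < 0)
    (hσ : m = mulVec (σ.permMatrix ℝ) (xvec q s)) {ε : ℝ} (hε : 0 < ε)
    (huniq : ∀ m' ∈ maximizers p q β h, m' ≠ m → ε < dist m m')
    (g : BoundedContinuousFunction (Vec q) ℝ) :
    Tendsto (fun N : ℕ => ∑ x : Fin N → Fin q, weight p N β h x * Real.exp (-(N * H p β h m)) *
      (if dist (magnetization x) m < ε then g (magnetization x) else 0)) atTop
      (𝓝 (√(((q : ℝ) - 1) / q ^ 2) * tau p q β h s m * g m)) := by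
  -- At scale `1/√N` a fixed test function is seen only through its value at `m`, so the limit
  -- function is constant; with no perturbation the drift vanishes.
  have h1 := tendsto_sum_weight hp 0 0 hm hQ hε huniq (σ.symm 0)
    (Φ := fun _ t => if dist t m < ε then g t else 0) (Ψ := fun _ => g m) (C := ‖g‖)
    (fun N t => by
      split_ifs
      · exact g.norm_coe_le_norm t
      · simp)
    (fun N t ht => if_neg (by rw [dist_eq_norm]; exact not_lt.2 ht))
    (fun W w hW => by
      have hlim : Tendsto (fun N : ℕ => m + (√(N : ℝ))⁻¹ • W N) atTop (𝓝 m) := by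
        simpa using (tendsto_inv_sqrt_natCast.smul hW).const_add m
      refine ((g.continuous.tendsto m).comp hlim).congr' ?_
      filter_upwards [hlim.eventually (Metric.ball_mem_nhds m hε)] with N hN
      exact (if_pos hN).symm)
  have h2 := integral_exp_Q_mul_eq hp hq hm hQ hσ 0 (BoundedContinuousFunction.const _ (g m))
  have h3 : drift p 0 0 m = 0 := by ext r; simp [drift]
  simp only [BoundedContinuousFunction.const_apply, integral_const, probReal_univ, one_smul] at h2
  rw [h3, h2] at h1
  simp only [WithLp.ofLp_zero, zero_dotProduct, zero_div, Real.exp_zero, mul_one] at h1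
  refine h1.congr fun N => ?_
  simp [logNormalization]

open Classical Matrix in
/-- Conditional central limit theorem near a maximizer. -/
lemma weakConv_cond (hp : 2 ≤ p) (hq : 2 ≤ q) (hm : m ∈ maximizers p q β h)
    (hQ : ∀ t : Vec q, ∑ r, t r = 0 → t ≠ 0 → Q p β m t < 0)
    (hσ : m = mulVec (σ.permMatrix ℝ) (xvec q s)) {ε : ℝ} (hε : 0 < ε)
    (huniq : ∀ m' ∈ maximizers p q β h, m' ≠ m → ε < dist m m') (β' h' : ℝ) :
    WeakConv (fun N => (ProbabilityTheory.cond (potts p q N (β + β' / √N) (h + h' / √N))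
        {x | magnetization x ∈ Metric.ball m ε}).map fun x => √N • (magnetization x - m))
      (multivariateGaussian
        (mulVec (σ.permMatrix ℝ * Sig p q β h s * (σ.permMatrix ℝ)ᵀ) (drift p β' h' m))
        (σ.permMatrix ℝ * Sig p q β h s * (σ.permMatrix ℝ)ᵀ)) := by
  intro g
  have key : ∀ g : BoundedContinuousFunction (Vec q) ℝ,
      Tendsto (fun N : ℕ => ∑ x : Fin N → Fin q, weight p N (β + β' / √N) (h + h' / √N) x *
        Real.exp (-logNormalization p N β h β' h' m) *
        (if dist (magnetization x) m < ε then g (√N • (magnetization x - m)) else 0)) atTop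
      (𝓝 (√(((q : ℝ) - 1) / q ^ 2) * tau p q β h s m *
        Real.exp ((drift p β' h' m).ofLp ⬝ᵥ
          (σ.permMatrix ℝ * Sig p q β h s * (σ.permMatrix ℝ)ᵀ) *ᵥ (drift p β' h' m).ofLp / 2) *
        ∫ x, g x ∂(multivariateGaussian
          (mulVec (σ.permMatrix ℝ * Sig p q β h s * (σ.permMatrix ℝ)ᵀ) (drift p β' h' m))
          (σ.permMatrix ℝ * Sig p q β h s * (σ.permMatrix ℝ)ᵀ)))) := by
    intro g
    have h1 := tendsto_sum_weight hp β' h' hm hQ hε huniq (σ.symm 0)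
      (Φ := fun N t => if dist t m < ε then g (√(N : ℝ) • (t - m)) else 0) (Ψ := g) (C := ‖g‖)
      (fun N t => by
        split_ifs
        · exact g.norm_coe_le_norm _
        · simp)
      (fun N t ht => if_neg (by rw [dist_eq_norm]; exact not_lt.2 ht))
      (fun W w hW => by
        have hlim : Tendsto (fun N : ℕ => m + (√(N : ℝ))⁻¹ • W N) atTop (𝓝 m) := by
          simpa using (tendsto_inv_sqrt_natCast.smul hW).const_add m
        refine ((g.continuous.tendsto w).comp hW).congr' ?_
        filter_upwards [hlim.eventually (Metric.ball_mem_nhds m hε), eventually_ne_atTop 0] with N hN hN0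
        have : √(N : ℝ) ≠ 0 := by positivity
        rw [if_pos hN, add_sub_cancel_left, smul_smul, mul_inv_cancel₀ this, one_smul,
          Function.comp_apply])
    rwa [integral_exp_Q_mul_eq hp hq hm hQ hσ] at h1
  -- The test function 1 gives the denominator of the conditional expectation; the common factor is
  -- positive and cancels in the quotient.
  have hone := key (BoundedContinuousFunction.const _ 1)
  simp only [BoundedContinuousFunction.const_apply, integral_const, probReal_univ, one_smul,
    mul_one] at hone
  have hq1 : (0 : ℝ) < (q : ℝ) - 1 := by
    have : (2 : ℝ) ≤ q := by exact_mod_cast hq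
    linarith
  have htau := (gaussian_normalization_eq_tau hp hq hm hQ hσ).2
  have hne : √(((q : ℝ) - 1) / q ^ 2) * tau p q β h s m *
        Real.exp ((drift p β' h' m).ofLp ⬝ᵥ
          (σ.permMatrix ℝ * Sig p q β h s * (σ.permMatrix ℝ)ᵀ) *ᵥ (drift p β' h' m).ofLp / 2) ≠ 0 := by
    positivity
  have hdiv := (key g).div hone hne
  rw [mul_div_cancel_left₀ _ hne] at hdiv
  refine hdiv.congr fun N => ?_
  rw [integral_map Measurable.of_discrete.aemeasurable g.continuous.aestronglyMeasurable,
    integral_cond_potts]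
  simp only [Pi.div_apply, Set.mem_ofPred_eq, Metric.mem_ball]
  have hE : Real.exp (-logNormalization p N β h β' h' m) ≠ 0 := (Real.exp_pos _).ne'
  simp only [mul_right_comm _ (Real.exp (-logNormalization p N β h β' h' m)), ← Finset.sum_mul]
  rw [mul_div_mul_right _ _ hE]

end PermutedMaximizer

open Classical in
/-- Convergence of the law of the magnetization to a mixture of point masses at the maximizers. -/
lemma weakConv_magnetization {p q : ℕ} [NeZero q] (hp : 2 ≤ p) (hq : 2 ≤ q) {β h : ℝ} {K : ℕ}
    [NeZero K] {m : Fin K → Vec q} {s : Fin K → ℝ} {σ : Fin K → Equiv.Perm (Fin q)}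
    (hinj : Function.Injective m) (hrange : Set.range m = maximizers p q β h)
    (hQ : ∀ i, ∀ t : Vec q, ∑ r, t r = 0 → t ≠ 0 → Q p β (m i) t < 0)
    (hσ : ∀ i, m i = mulVec ((σ i).permMatrix ℝ) (xvec q (s i))) :
    WeakConv (fun N => (potts p q N β h).map magnetization)
      (∑ i, ENNReal.ofReal (tau p q β h (s i) (m i) / ∑ j, tau p q β h (s j) (m j)) •
        Measure.dirac (m i)) := by
  have hm : ∀ i, m i ∈ maximizers p q β h := fun i => hrange ▸ Set.mem_range_self i
  have htau : ∀ i, 0 < tau p q β h (s i) (m i) := fun i =>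
    (gaussian_normalization_eq_tau hp hq (hm i) (hQ i) (hσ i)).2
  -- Half the minimal distance is not exceeded, so the balls of radius `ε` around the maximizers are
  -- disjoint.
  obtain ⟨ε, hε, hdist⟩ : ∃ ε : ℝ, 0 < ε ∧ ∀ i j, i ≠ j → 2 * ε < dist (m i) (m j) := by
    have h1 : ∀ i j, ∃ ε : ℝ, 0 < ε ∧ (i ≠ j → 2 * ε < dist (m i) (m j)) := fun i j => by
      by_cases hij : i = j
      · exact ⟨1, one_pos, fun h => absurd hij h⟩
      · have := dist_pos.2 (hinj.ne hij)
        exact ⟨dist (m i) (m j) / 4, by positivity, fun _ => by linarith⟩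
    choose e he hlt using h1
    obtain ⟨a, ha⟩ := Finite.exists_min fun x : Fin K × Fin K => e x.1 x.2
    exact ⟨e a.1 a.2, he _ _, fun i j hij => by linarith [hlt i j hij, ha (i, j)]⟩
  have huniq : ∀ i, ∀ m' ∈ maximizers p q β h, m' ≠ m i → ε < dist (m i) m' := by
    intro i m' hm' hne
    rw [← hrange] at hm'
    obtain ⟨j, rfl⟩ := hm'
    linarith [hdist i j fun h => hne (by rw [h])]
  have hdisj : ∀ t i j, dist t (m i) < ε → dist t (m j) < ε → i = j := by
    intro t i j hi hj
    by_contra hij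
    have := dist_triangle_left (m i) (m j) t
    linarith [hdist i j hij]
  set γ : ℝ := √(((q : ℝ) - 1) / q ^ 2) with hγ
  have hγpos : 0 < γ := by
    have : (2 : ℝ) ≤ q := by exact_mod_cast hq
    have : 0 < (q : ℝ) - 1 := by linarith
    positivity
  set E : ℕ → ℝ := fun N => Real.exp (-(N * H p β h (m 0))) with hE
  have hHeq : ∀ i, H p β h (m i) = H p β h (m 0) := fun i => H_eq_of_maximizers (hm i) (hm 0)
  have key : ∀ g : BoundedContinuousFunction (Vec q) ℝ,
      Tendsto (fun N : ℕ => ∑ x : Fin N → Fin q, weight p N β h x * E N * g (magnetization x)) atTop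
        (𝓝 (γ * ∑ i, tau p q β h (s i) (m i) * g (m i))) := by
    intro g
    -- The part of `g` outside the balls. Disjointness makes it vanish inside each ball and keeps it
    -- bounded by the norm of `g`.
    set R : Vec q → ℝ := fun t => g t - ∑ i, if dist t (m i) < ε then g t else 0 with hR
    have hRzero : ∀ t, ∀ m' ∈ maximizers p q β h, dist t m' < ε → R t = 0 := by
      intro t m' hm' ht
      rw [← hrange] at hm'
      obtain ⟨i, rfl⟩ := hm'
      simp only [hR]
      rw [Finset.sum_eq_single i (fun j _ hj => if_neg fun hlt => hj (hdisj t j i hlt ht))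
        (fun h => absurd (Finset.mem_univ i) h), if_pos ht, sub_self]
    have hRbound : ∀ t, |R t| ≤ ‖g‖ := by
      intro t
      by_cases ht : ∃ i, dist t (m i) < ε
      · obtain ⟨i, hi⟩ := ht
        rw [hRzero t (m i) (hm i) hi]
        simp
      · push Not at ht
        simp only [hR]
        rw [Finset.sum_eq_zero fun i _ => if_neg (not_lt.2 (ht i)), sub_zero]
        exact g.norm_coe_le_norm t
    have h1 := tendsto_sum_weight_of_away (hm 0) hRbound hε hRzero
    have h2 := tendsto_finsetSum Finset.univ fun i _ =>
      tendsto_sum_weight_ball hp hq (hm i) (hQ i) (hσ i) hε (huniq i) g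
    have h3 := h2.add h1
    have hlim : ∑ i, √(((q : ℝ) - 1) / q ^ 2) * tau p q β h (s i) (m i) * g (m i) + 0 =
        γ * ∑ i, tau p q β h (s i) (m i) * g (m i) := by
      rw [add_zero, Finset.mul_sum]
      exact Finset.sum_congr rfl fun i _ => mul_assoc _ _ _
    rw [hlim] at h3
    refine h3.congr fun N => ?_
    rw [Finset.sum_comm, ← Finset.sum_add_distrib]
    refine Finset.sum_congr rfl fun x _ => ?_
    simp only [hHeq]
    rw [← Finset.mul_sum, ← mul_add]
    simp only [hR, hE]
    ring
  intro g
  have hone := key (BoundedContinuousFunction.const _ 1)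
  simp only [BoundedContinuousFunction.const_apply, mul_one] at hone
  have hsum : 0 < ∑ i, tau p q β h (s i) (m i) :=
    Finset.sum_pos (fun i _ => htau i) ⟨0, Finset.mem_univ _⟩
  have hdiv := (key g).div hone (mul_pos hγpos hsum).ne'
  rw [mul_div_mul_left _ _ hγpos.ne'] at hdiv
  have hlim : ∫ x, g x ∂(∑ i, ENNReal.ofReal (tau p q β h (s i) (m i) /
      ∑ j, tau p q β h (s j) (m j)) • Measure.dirac (m i)) =
      (∑ i, tau p q β h (s i) (m i) * g (m i)) / ∑ i, tau p q β h (s i) (m i) := by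
    rw [integral_finsetSum_measure fun i _ => (g.integrable _).smul_measure ENNReal.ofReal_ne_top,
      Finset.sum_div]
    refine Finset.sum_congr rfl fun i _ => ?_
    rw [integral_smul_measure, integral_dirac,
      ENNReal.toReal_ofReal (div_nonneg (htau i).le hsum.le), smul_eq_mul]
    ring
  rw [hlim]
  refine hdiv.congr fun N => ?_
  rw [integral_map Measurable.of_discrete.aemeasurable g.continuous.aestronglyMeasurable,
    integral_potts]
  have hE0 : E N ≠ 0 := (Real.exp_pos _).ne'
  simp only [Pi.div_apply, mul_right_comm _ (E N), ← Finset.sum_mul]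
  rw [mul_div_mul_right _ _ hE0]

end TensorPotts
end
theorem theorem2p3 (p q : ℕ) [NeZero q] (hp : 2 ≤ p) (hq : 2 ≤ q) (β h : ℝ) (hβ : 0 < β)
    (hh : 0 ≤ h) (hcrit : TensorPotts.IsCritical p q β h) :
    -- the maximizers are finitely many, and each is a permutation of some `x_s` with `0 ≤ s < 1`
    ∃ (K : ℕ) (m : Fin K → TensorPotts.Vec q) (s : Fin K → ℝ),
      Function.Injective m ∧ Set.range m = TensorPotts.maximizers p q β h ∧
      (∀ i, 0 ≤ s i ∧ s i < 1 ∧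
        ∃ σ : Equiv.Perm (Fin q),
          m i = TensorPotts.mulVec (σ.permMatrix ℝ) (TensorPotts.xvec q (s i))) ∧
      -- convergence of the magnetization to the mixture
      TensorPotts.WeakConv
        (fun N => (TensorPotts.potts p q N β h).map TensorPotts.magnetization)
        (∑ i, ENNReal.ofReal (TensorPotts.tau p q β h (s i) (m i) /
            ∑ j, TensorPotts.tau p q β h (s j) (m j)) • Measure.dirac (m i)) ∧
      -- conditional central limit theorem under perturbed parameters
      ∀ (β' h' ε : ℝ), 0 < ε → (∀ i j, i ≠ j → ε < dist (m i) (m j)) →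
        ∀ (i : Fin K) (σ : Equiv.Perm (Fin q)),
          m i = TensorPotts.mulVec (σ.permMatrix ℝ) (TensorPotts.xvec q (s i)) →
          (σ.permMatrix ℝ * TensorPotts.Sig p q β h (s i) *
            (σ.permMatrix ℝ).transpose).PosSemidef ∧
          TensorPotts.WeakConv
            (fun N => (ProbabilityTheory.cond
                (TensorPotts.potts p q N (β + β' / Real.sqrt N) (h + h' / Real.sqrt N))
                {x | TensorPotts.magnetization x ∈ Metric.ball (m i) ε}).map
              fun x => Real.sqrt N • (TensorPotts.magnetization x - m i))
            (ProbabilityTheory.multivariateGaussian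
              (TensorPotts.mulVec (σ.permMatrix ℝ * TensorPotts.Sig p q β h (s i) *
                (σ.permMatrix ℝ).transpose) (TensorPotts.drift p β' h' (m i)))
              (σ.permMatrix ℝ * TensorPotts.Sig p q β h (s i) *
                (σ.permMatrix ℝ).transpose)) := by
  have hfin := TensorPotts.finite_maximizers hp hcrit.2
  have := hfin.to_subtype
  obtain ⟨K, ⟨e⟩⟩ := Finite.exists_equiv_fin (TensorPotts.maximizers p q β h)
  have hK : NeZero K := by
    obtain ⟨m₀, hm₀⟩ := hcrit.1.nonempty
    exact ⟨fun h0 => (h0 ▸ e ⟨m₀, hm₀⟩ : Fin 0).elim0⟩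
  set m : Fin K → TensorPotts.Vec q := fun i => e.symm i with hm
  have hmem : ∀ i, m i ∈ TensorPotts.maximizers p q β h := fun i => (e.symm i).2
  have hinj : Function.Injective m := Subtype.val_injective.comp e.symm.injective
  have hrange : Set.range m = TensorPotts.maximizers p q β h := by
    rw [hm, Set.range_comp' Subtype.val, e.symm.surjective.range_eq, Set.image_univ,
      Subtype.range_coe]
  -- The permutations chosen here serve the mixture only; the conditional limit is proved for an
  -- arbitrary `τ` representing the same maximizer.
  choose s hs0 hs1 σ hσ using fun i => TensorPotts.maximizer_eq_permMatrix_mulVec_xvec hp hq hβ hh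
    (hmem i) (hcrit.2 _ (hmem i))
  refine ⟨K, m, s, hinj, hrange, fun i => ⟨hs0 i, hs1 i, σ i, hσ i⟩,
    TensorPotts.weakConv_magnetization hp hq hinj hrange (fun i => hcrit.2 _ (hmem i)) hσ,
    fun β' h' ε hε hdist i τ hτ => ?_⟩
  have huniq : ∀ m' ∈ TensorPotts.maximizers p q β h, m' ≠ m i → ε < dist (m i) m' := by
    intro m' hm' hne
    rw [← hrange] at hm'
    obtain ⟨j, rfl⟩ := hm'
    exact hdist i j fun hij => hne (by rw [hij])
  exact ⟨TensorPotts.posSemidef_permMatrix_mul_Sig hp hq (hmem i) (hcrit.2 _ (hmem i)) hτ,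
    TensorPotts.weakConv_cond hp hq (hmem i) (hcrit.2 _ (hmem i)) hτ hε huniq β' h'⟩
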